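/- Let $\{X_t\}_{t\ge 0}$ be a time-homogeneous Markov process with values in a measurable space $S$, with transition semigroup of Markov kernels $(P_t)_{t\ge0}$, stationary with $X_t\sim\mu$ for all $t$, and reversible (each $P_t$ satisfies detailed balance with respect to $\mu$). Let $$\mathrm{L}f(x)=\lim_{t\to0^+}\frac{\mathbb{E}[f(X_t)\mid X_0=x]-f(x)}{t}$$ be its infinitesimal generator, whose domain consists of those measurable $f:S\to\mathbb{R}$ for which (the conditional expectations are finite for small $t>0$ and) this limit exists uniformly in $x\in S$, and let $\Gamma(f,g)=\frac12[\mathrm{L}(fg)-f\,\mathrm{L}g-g\,\mathrm{L}f]$ be the carré du champ. For $F,G:S\to\mathbb{R}^d$ put $(\mathrm{L}F)_j=\mathrm{L}(F_j)$ and $\Gamma(F,G)_{jk}=\Gamma(F_j,G_k)$. Let $F:S\to\mathbb{R}^d$ be such that all $F_j$ and all products $F_jF_k$ are in the domain of $\mathrm{L}$, $F(X_0)$ is integrable, and $\mathbb{E}F(X_0)=0$. Suppose that there are an invertible deterministic matrix $\Lambda\in M_d(\mathbb{R})$, a positive semidefinite symmetric deterministic matrix $\Sigma\in M_d(\mathbb{R})$,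 an $X_0$-measurable random vector $E_1\in\mathbb{R}^d$ and an $X_0$-measurable random matrix $E_2\in M_d(\mathbb{R})$ such that, almost surely, $$\mathrm{L}F(X_0)=-\Lambda F(X_0)+E_1,\qquad \Gamma(F,F)(X_0)=\Lambda\Sigma+E_2,$$ and such that for each $\rho>0$ $$\lim_{t\to0^+}\frac1t\,\mathbb{E}\left[|F(X_t)-F(X_0)|^2\,\mathbf{1}_{\{|F(X_t)-F(X_0)|>\rho\}}\right]=0.$$ Let $Z_\Sigma\sim N(0,\Sigma)$, let $|\cdot|$ be the Euclidean norm, and let $\|\cdot\|_{op}$ and $\|\cdot\|_{HS}$ be the (Euclidean) operator norm and the Hilbert–Schmidt norm of matrices. Then for each $g\in C^2(\mathbb{R}^d)$ with gradient $\nabla g$ and Hessian matrix $D^2g$ for which the two suprema $\||\nabla g|\|_\infty=\sup_x|\nabla g(x)|$ and $\|\|D^2g\|_{HS}\|_\infty=\sup_x\|D^2g(x)\|_{HS}$ are finite, $g(F(X_0))$ and $g(Z_\Sigma)$ are integrable and $$\left|\mathbb{E}g(F(X_0))-\mathbb{E}g(Z_\Sigma)\right|\le\|\Lambda^{-1}\|_{op}\left[\||\nabla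 g|\|_\infty\,\mathbb{E}|E_1|+\tfrac12\,\|\|D^2g\|_{HS}\|_\infty\,\mathbb{E}\|E_2\|_{HS}\right].$$ If $\Sigma$ is nonsingular, then moreover $$d_W(F(X_0),Z_\Sigma)\le\|\Lambda^{-1}\|_{op}\left[\mathbb{E}|E_1|+\|\Sigma^{-1/2}\|_{op}\,\mathbb{E}\|E_2\|_{HS}\right],$$ where $d_W(X,Y)=\sup_f|\mathbb{E}f(X)-\mathbb{E}f(Y)|$, the supremum being over all $1$-Lipschitz $f:\mathbb{R}^d\to\mathbb{R}$, is the $L^1$-Wasserstein distance. -/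

import Mathlib

open MeasureTheory ProbabilityTheory Filter Topology
open scoped NNReal ENNReal

noncomputable section

namespace SteinMarkov

/-! ### Markov processes, generator, carré du champ -/

section Markov

variable {S Ω : Type*} [MeasurableSpace S] [MeasurableSpace Ω]

/-- `(X t)_{t ≥ 0}` is, on the probability space `(Ω, P)`, a (time-homogeneous) Markov process with
values in the measurable space `S` and transition semigroup `κ`
(`κ t x` is the law of `X t` given `X 0 = x`); it is stationary with law `μ` at each time, and
`μ` is reversible for the semigroup. -/
structure IsStationaryReversibleMarkov (κ : ℝ≥0 → Kernel S S) (μ : Measure S)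
    (P : Measure Ω) (X : ℝ≥0 → Ω → S) : Prop where
  /-- the semigroup consists of Markov kernels -/
  isMarkovKernel : ∀ t, IsMarkovKernel (κ t)
  /-- at time zero the semigroup is the identity -/
  kernel_zero : κ 0 = Kernel.id
  /-- Chapman-Kolmogorov equation -/
  kernel_add : ∀ s t, κ (s + t) = κ t ∘ₖ κ s
  measurable : ∀ t, Measurable (X t)
  /-- Markov property: the conditional law of `X (s + t)` given the past `(X r)_{r ≤ s}`
  is `κ t (X s)` -/
  markov : ∀ (s t : ℝ≥0) (A : Set S), MeasurableSet A →
    P[(X (s + t) ⁻¹' A).indicator (fun _ => (1 : ℝ)) |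
        ⨆ r : {r : ℝ≥0 // r ≤ s}, MeasurableSpace.comap (X r) inferInstance]
      =ᵐ[P] fun ω => (κ t (X s ω)).real A
  stationary : ∀ t, P.map (X t) = μ
  reversible : ∀ t, (κ t).IsReversible μ

/-- The difference quotient `(𝔼[f(X_t) | X_0 = x] - f(x)) / t`. -/
def diffQuotient (κ : ℝ≥0 → Kernel S S) (f : S → ℝ) (t : ℝ≥0) (x : S) : ℝ :=
  ((∫ y, f y ∂(κ t x)) - f x) / t

/-- The infinitesimal generator
`L f (x) = lim_{t → 0+} (𝔼[f(X_t) | X_0 = x] - f(x)) / t`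
(to be used for `f` in the domain of the generator only, see `InDomain`). -/
def generator (κ : ℝ≥0 → Kernel S S) (f : S → ℝ) (x : S) : ℝ :=
  limUnder (𝓝[>] (0 : ℝ≥0)) (fun t => diffQuotient κ f t x)

/-- The domain of the generator: measurable functions `f` for which, for small `t > 0`,
the conditional expectation `𝔼[f(X_t) | X_0 = x]` makes sense for each `x`, and for which
the limit that defines `L f` exists uniformly in `x`. -/
def InDomain (κ : ℝ≥0 → Kernel S S) (f : S → ℝ) : Prop :=
  Measurable f ∧ (∀ᶠ t in 𝓝[>] (0 : ℝ≥0), ∀ x, Integrable f (κ t x)) ∧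
    ∃ h : S → ℝ, TendstoUniformly (diffQuotient κ f) h (𝓝[>] (0 : ℝ≥0))

/-- The carré du champ `Γ(f, g) = (L(fg) - f L g - g L f) / 2`. -/
def carreDuChamp (κ : ℝ≥0 → Kernel S S) (f g : S → ℝ) (x : S) : ℝ :=
  1 / 2 * (generator κ (fun y => f y * g y) x - f x * generator κ g x - g x * generator κ f x)

variable {d : ℕ}

/-- The generator applied to a vector-valued function: `(L F)_j = L (F_j)`. -/
def generatorVec (κ : ℝ≥0 → Kernel S S) (F : S → EuclideanSpace ℝ (Fin d)) (x : S) :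
    EuclideanSpace ℝ (Fin d) :=
  WithLp.toLp 2 fun j => generator κ (fun y => F y j) x

/-- The matrix-valued carré du champ: `Γ(F, G)_{jk} = Γ(F_j, G_k)`. -/
def carreDuChampMat (κ : ℝ≥0 → Kernel S S) (F G : S → EuclideanSpace ℝ (Fin d)) (x : S) :
    Matrix (Fin d) (Fin d) ℝ :=
  Matrix.of fun j k => carreDuChamp κ (fun y => F y j) (fun y => G y k) x

end Markov

/-! ### Matrix norms, inverse square root, Hessian, Wasserstein distance -/

section Euclidean

variable {d : ℕ}

/-- The operator norm of a matrix with respect to the Euclidean norm. -/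
def opNorm (A : Matrix (Fin d) (Fin d) ℝ) : ℝ :=
  ‖Matrix.toEuclideanCLM (n := Fin d) (𝕜 := ℝ) A‖

/-- The Hilbert-Schmidt norm of a matrix. -/
def hsNorm (A : Matrix (Fin d) (Fin d) ℝ) : ℝ :=
  Real.sqrt (∑ j, ∑ k, A j k ^ 2)

open scoped MatrixOrder in
/-- `A^{-1/2}`, the inverse of the positive semidefinite square root of a positive definite `A`. -/
def invSqrt (A : Matrix (Fin d) (Fin d) ℝ) : Matrix (Fin d) (Fin d) ℝ :=
  (CFC.sqrt A)⁻¹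

/-- The Hessian matrix `D² g (x)`. -/
def hessian (g : EuclideanSpace ℝ (Fin d) → ℝ) (x : EuclideanSpace ℝ (Fin d)) :
    Matrix (Fin d) (Fin d) ℝ :=
  Matrix.of fun j k =>
    fderiv ℝ (fderiv ℝ g) x (EuclideanSpace.single j 1) (EuclideanSpace.single k 1)

/-- `‖ |∇ g| ‖_∞`, the supremum over `ℝ^d` of the Euclidean norm of the gradient. -/
def supGrad (g : EuclideanSpace ℝ (Fin d) → ℝ) : ℝ≥0∞ :=
  ⨆ x, ENNReal.ofReal ‖gradient g x‖

/-- `‖ ‖D² g‖_HS ‖_∞`, the supremum over `ℝ^d` of the Hilbert-Schmidt norm of the Hessian. -/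
def supHess (g : EuclideanSpace ℝ (Fin d) → ℝ) : ℝ≥0∞ :=
  ⨆ x, ENNReal.ofReal (hsNorm (hessian g x))

/-- The `L¹` Wasserstein distance of two probability measures with finite first moments, as the
supremum of `|∫ f dν₁ - ∫ f dν₂|` over all `1`-Lipschitz functions `f`. -/
def wasserstein (ν₁ ν₂ : Measure (EuclideanSpace ℝ (Fin d))) : ℝ≥0∞ :=
  ⨆ (f : EuclideanSpace ℝ (Fin d) → ℝ) (_ : LipschitzWith 1 f),
    ENNReal.ofReal |(∫ x, f x ∂ν₁) - ∫ x, f x ∂ν₂|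

end Euclidean

end SteinMarkov

end

open SteinMarkov

/-!
# Normal approximation by an infinitesimal Stein method

Write `W = F(X₀)`, let `N` be a standard Gaussian vector independent of `W`, and let `A = Σ^{1/2}`,
so that `A N` has law `N(0, Σ)`. The two expectations are compared along the rotation
`θ ↦ 𝔼 g(sin θ W + cos θ A N)`, `0 ≤ θ ≤ π / 2`. By Gaussian integration by parts
(`integral_coord_mul_stdGaussian`), its derivative is `cos θ` times the expectation, under the law of
`W`, of the Stein operator `⟨x, φ(x)⟩ - ⟨Σ, Dφ(x)⟩` of `N(0, Σ)`, evaluated at the smoothed gradient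
`φ(x) = 𝔼 ∇g(sin θ x + cos θ A N)` (`hasDerivAt_interpolation_steinOperator`). The rotation plays the
role of a solution of the Stein equation, and no singularity in `θ` occurs.

The expectation of the Stein operator is small by reversibility: the law of `(X₀, X_t)` is symmetric,
so `(F_j(X_t) - F_j(X₀)) (ψ(F(X_t)) + ψ(F(X₀)))` has mean zero for a bounded `C¹` function `ψ`.
Divided by `t`, and with a Taylor expansion whose remainder is negligible by the Lindeberg condition,
this becomes `𝔼 [ψ(W) (L F)_j + ∑_k ∂_k ψ(W) Γ(F, F)_jk] = 0` in the limit `t → 0`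
(`integral_generator_add_carreDuChamp_eq_zero`). Inserting `L F = -Λ F + E₁` and
`Γ(F, F) = Λ Σ + E₂` and multiplying by `Λ⁻¹` leaves only error terms
(`abs_integral_steinOperator_le`).

It remains to bound `φ` and `Dφ`. Always `|φ| ≤ sup |∇g|` and `‖Dφ‖ ≤ sin θ · sup ‖D²g‖`; integration
over `θ` gives the factors `1` and `1 / 2`. If `Σ` is nonsingular, a second Gaussian integration by
parts gives `cos θ ‖Dφ‖ ≤ sin θ ‖Σ^{-1/2}‖ sup |∇g|`
(`mul_hsNorm_jacobian_smoothedGradient_le`), in which no second derivative of `g` occurs, so that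
`g` may be replaced by any `1`-Lipschitz function after mollification (`exists_contDiff_approx`).

All estimates need `E₂` to be integrable. Otherwise the bounds are infinite, except for an affine `g`,
for which the two expectations agree since both laws are centred.
-/

/-! ### Gaussian integration by parts -/

theorem hasDerivAt_gaussianPDFReal_zero_one (x : ℝ) :
    HasDerivAt (gaussianPDFReal 0 1) (-(x * gaussianPDFReal 0 1 x)) x := by
  have h1 : HasDerivAt (fun y : ℝ => -(y - 0) ^ 2 / (2 * ((1 : ℝ≥0) : ℝ))) (-x) x := by
    have h2 := (((hasDerivAt_id x).sub_const 0).pow 2).neg.div_const (2 * ((1 : ℝ≥0) : ℝ))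
    refine h2.congr_deriv ?_
    simp [neg_div]
  have h3 := h1.exp.const_mul (√(2 * Real.pi * (1 : ℝ≥0)))⁻¹
  rw [gaussianPDFReal_def]
  refine h3.congr_deriv ?_
  ring

/-- Stein's identity for the standard Gaussian measure on `ℝ`. -/
theorem integral_id_mul_gaussianReal_zero_one {u u' : ℝ → ℝ} {C C' : ℝ}
    (hu : ∀ x, HasDerivAt u (u' x) x) (hC : ∀ x, |u x| ≤ C) (hC' : ∀ x, |u' x| ≤ C') :
    ∫ x, x * u x ∂(gaussianReal 0 1) = ∫ x, u' x ∂(gaussianReal 0 1) := by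
  have hum : Measurable u :=
    (continuous_iff_continuousAt.2 fun x => (hu x).continuousAt).measurable
  have hum' : Measurable u' := by
    have : u' = deriv u := funext fun x => (hu x).deriv.symm
    rw [this]
    exact measurable_deriv u
  have hi : Integrable (gaussianPDFReal 0 1) := integrable_gaussianPDFReal 0 1
  have hxi : Integrable (fun x : ℝ => x * gaussianPDFReal 0 1 x) := by
    have h := (IsGaussian.integrable_id (μ := gaussianReal 0 1))
    rw [gaussianReal_of_var_ne_zero 0 one_ne_zero, gaussianPDF_def,
      integrable_withDensity_iff_integrable_smul₀' (by fun_prop) (by simp)] at h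
    refine h.congr (ae_of_all _ fun x => ?_)
    simp [ENNReal.toReal_ofReal (gaussianPDFReal_nonneg 0 1 x), mul_comm]
  rw [integral_gaussianReal_eq_integral_smul one_ne_zero,
    integral_gaussianReal_eq_integral_smul one_ne_zero]
  have key := integral_mul_deriv_eq_deriv_mul_of_integrable (u := u) (u' := u')
    (v := gaussianPDFReal 0 1) (v' := fun x => -(x * gaussianPDFReal 0 1 x))
    (fun x _ => hu x) (fun x _ => hasDerivAt_gaussianPDFReal_zero_one x)
    (hxi.neg.bdd_mul hum.aestronglyMeasurable (ae_of_all _ hC))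
    (hi.bdd_mul hum'.aestronglyMeasurable (ae_of_all _ hC'))
    (hi.bdd_mul hum.aestronglyMeasurable (ae_of_all _ hC))
  have h2 : ∫ x, gaussianPDFReal 0 1 x • (x * u x) = - ∫ x, u x * -(x * gaussianPDFReal 0 1 x) := by
    rw [← integral_neg]
    congr 1 with x
    simp only [smul_eq_mul]
    ring
  rw [h2, key, neg_neg]
  congr 1 with x
  simp only [smul_eq_mul]
  ring

/-- Integration by parts for the standard Gaussian measure `γ` on `ℝ^d`: `∫ n_k f = ∫ ∂_k f`. It
follows from the one-dimensional case by Fubini. -/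
theorem integral_coord_mul_stdGaussian {d : ℕ} {f : EuclideanSpace ℝ (Fin d) → ℝ} {C C' : ℝ}
    (hf : ContDiff ℝ 1 f) (hC : ∀ x, |f x| ≤ C) (hC' : ∀ x, ‖fderiv ℝ f x‖ ≤ C') (k : Fin d) :
    ∫ n, n k * f n ∂(stdGaussian (EuclideanSpace ℝ (Fin d))) =
      ∫ n, fderiv ℝ f n (EuclideanSpace.single k 1) ∂(stdGaussian (EuclideanSpace ℝ (Fin d))) := by
  obtain _ | m := d
  · exact k.elim0
  have hfm : Measurable f := hf.continuous.measurable
  have hfd : Continuous (fderiv ℝ f) := hf.continuous_fderiv one_ne_zero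
  have hdm : Measurable fun n => fderiv ℝ f n (EuclideanSpace.single k 1) :=
    (hfd.clm_apply continuous_const).measurable
  rw [← map_pi_eq_stdGaussian, integral_map (by fun_prop) (by fun_prop),
    integral_map (by fun_prop) hdm.aestronglyMeasurable]
  have mp := (measurePreserving_piFinSuccAbove
    (fun _ : Fin (m + 1) => gaussianReal 0 1) k).symm
  rw [← mp.integral_comp', ← mp.integral_comp']
  have hdb : ∀ n, |fderiv ℝ f n (EuclideanSpace.single k 1)| ≤ C' := fun n => by
    have := (fderiv ℝ f n).le_opNorm (EuclideanSpace.single k 1)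
    rw [Real.norm_eq_abs, PiLp.norm_single] at this
    simp only [norm_one, mul_one] at this
    exact this.trans (hC' n)
  have hemb : Measurable fun p : ℝ × (Fin m → ℝ) =>
      WithLp.toLp 2 ((MeasurableEquiv.piFinSuccAbove (fun _ => ℝ) k).symm p) :=
    (by fun_prop : Measurable (WithLp.toLp 2)).comp (MeasurableEquiv.measurable _)
  have hk : ∀ p : ℝ × (Fin m → ℝ),
      (MeasurableEquiv.piFinSuccAbove (fun _ : Fin (m + 1) => ℝ) k).symm p k = p.1 :=
    fun p => by simp
  simp only [hk]
  rw [integral_prod_symm, integral_prod_symm]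
  · congr 1 with y
    refine integral_id_mul_gaussianReal_zero_one (C := C) (C' := C') (fun x => ?_)
      (fun x => hC _) (fun x => hdb _)
    have hlin : ∀ x : ℝ,
        WithLp.toLp 2 ((MeasurableEquiv.piFinSuccAbove (fun _ => ℝ) k).symm (x, y)) =
        WithLp.toLp 2 ((MeasurableEquiv.piFinSuccAbove (fun _ => ℝ) k).symm (0, y)) +
          x • EuclideanSpace.single k (1 : ℝ) := fun x => by
      ext j
      refine Fin.succAboveCases k ?_ (fun i => ?_) j <;> simp
    have hx : HasDerivAt (fun x : ℝ =>
        WithLp.toLp 2 ((MeasurableEquiv.piFinSuccAbove (fun _ => ℝ) k).symm (x, y)))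
        (EuclideanSpace.single k (1 : ℝ)) x := by
      rw [funext hlin]
      simpa using ((hasDerivAt_id x).smul_const (EuclideanSpace.single k (1 : ℝ))).const_add
        (WithLp.toLp 2 ((MeasurableEquiv.piFinSuccAbove (fun _ => ℝ) k).symm (0, y)))
    exact ((hf.differentiable one_ne_zero _).hasFDerivAt).comp_hasDerivAt x hx
  · exact Integrable.of_bound (hdm.comp hemb).aestronglyMeasurable C' (ae_of_all _ fun p => hdb _)
  · refine Integrable.mul_bdd (c := C) ?_ (hfm.comp hemb).aestronglyMeasurable
      (ae_of_all _ fun p => hC _)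
    exact (IsGaussian.integrable_id (μ := gaussianReal 0 1)).comp_fst _

/-! ### Reversible semigroups: the generator and the joint law of two states -/

section Semigroup

variable {S : Type*} [MeasurableSpace S] {μ : Measure S} {κ : ℝ≥0 → Kernel S S}

theorem map_swap_compProd_of_isReversible [IsFiniteMeasure μ] {η : Kernel S S} [IsMarkovKernel η]
    (h : η.IsReversible μ) : (μ ⊗ₘ η).map Prod.swap = μ ⊗ₘ η := by
  have : IsFiniteMeasure ((μ ⊗ₘ η).map Prod.swap) := by infer_instance
  refine Measure.ext_prod fun {s t} hs ht => ?_
  rw [Measure.map_apply measurable_swap (hs.prod ht), Set.preimage_swap_prod,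
    Measure.compProd_apply_prod ht hs, Measure.compProd_apply_prod hs ht, h ht hs]

/-- The joint law of the states of the process at times `0` and `t` is `μ ⊗ₘ κ t`. -/
theorem SteinMarkov.IsStationaryReversibleMarkov.map_prodMk {Ω : Type*} [MeasurableSpace Ω]
    {P : Measure Ω} [IsProbabilityMeasure P] {X : ℝ≥0 → Ω → S}
    (hX : IsStationaryReversibleMarkov κ μ P X) (t : ℝ≥0) :
    P.map (fun ω => (X 0 ω, X t ω)) = μ ⊗ₘ κ t := by
  have := hX.isMarkovKernel t
  have hm0 := hX.measurable 0
  have hmt := hX.measurable t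
  have hμ : IsProbabilityMeasure μ := hX.stationary 0 ▸ Measure.isProbabilityMeasure_map
    hm0.aemeasurable
  have : IsFiniteMeasure (P.map (fun ω => (X 0 ω, X t ω))) := by infer_instance
  refine Measure.ext_prod fun {B A} hB hA => ?_
  have hm : (⨆ r : {r : ℝ≥0 // r ≤ 0}, MeasurableSpace.comap (X r) inferInstance) ≤
      (inferInstance : MeasurableSpace Ω) := iSup_le fun r => (hX.measurable r).comap_le
  have hBm : MeasurableSet[⨆ r : {r : ℝ≥0 // r ≤ 0}, MeasurableSpace.comap (X r) inferInstance]
      (X 0 ⁻¹' B) :=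
    (le_iSup (fun r : {r : ℝ≥0 // r ≤ 0} => MeasurableSpace.comap (X r) inferInstance)
      ⟨0, le_rfl⟩) _ ⟨B, hB, rfl⟩
  have hint : Integrable ((X (0 + t) ⁻¹' A).indicator fun _ => (1 : ℝ)) P :=
    (integrable_const _).indicator (hX.measurable _ hA)
  have h1 := setIntegral_condExp hm hint hBm
  have h2 : ∫ ω in X 0 ⁻¹' B, (κ t (X 0 ω)).real A ∂P = P.real (X t ⁻¹' A ∩ X 0 ⁻¹' B) := by
    rw [← setIntegral_congr_ae (hm0 hB) ((hX.markov 0 t A hA).mono fun ω h _ => h), h1,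
      zero_add]
    exact (integral_indicator_one (hX.measurable t hA)).trans
      (measureReal_restrict_apply (hX.measurable t hA))
  have h3 : ∫ ω in X 0 ⁻¹' B, (κ t (X 0 ω)).real A ∂P = ∫ x in B, (κ t x).real A ∂μ := by
    rw [← hX.stationary 0, setIntegral_map hB _ hm0.aemeasurable]
    exact ((κ t).measurable_coe hA).ennreal_toReal.aestronglyMeasurable
  rw [Measure.map_apply (by fun_prop) (hB.prod hA), Measure.compProd_apply_prod hB hA]
  have h4 : ∫⁻ x in B, κ t x A ∂μ = ENNReal.ofReal (∫ x in B, (κ t x).real A ∂μ) := by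
    rw [ofReal_integral_eq_lintegral_ofReal]
    · refine lintegral_congr fun x => ?_
      rw [measureReal_def, ENNReal.ofReal_toReal (measure_ne_top _ _)]
    · refine (Integrable.of_bound (C := 1)
        ((κ t).measurable_coe hA).ennreal_toReal.aestronglyMeasurable
        (ae_of_all _ fun x => ?_))
      rw [Real.norm_eq_abs, abs_of_nonneg measureReal_nonneg]
      exact measureReal_le_one
    · exact ae_of_all _ fun x => measureReal_nonneg
  rw [h4, ← h3, h2, measureReal_def, ENNReal.ofReal_toReal (measure_ne_top _ _)]
  congr 1
  ext ω
  simp [and_comm]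

theorem SteinMarkov.InDomain.tendstoUniformly_generator {f : S → ℝ} (hf : InDomain κ f) :
    TendstoUniformly (diffQuotient κ f) (generator κ f) (𝓝[>] 0) := by
  obtain ⟨-, -, h, hh⟩ := hf
  have : generator κ f = h := funext fun x => (hh.tendsto_at x).limUnder_eq
  rwa [this]

theorem measurable_diffQuotient {f : S → ℝ} (hf : Measurable f) (t : ℝ≥0) [IsMarkovKernel (κ t)] :
    Measurable (diffQuotient κ f t) :=
  ((hf.stronglyMeasurable.integral_kernel).measurable.sub hf).div_const _

theorem SteinMarkov.InDomain.measurable_generator {f : S → ℝ} (hf : InDomain κ f)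
    (hκ : ∀ t, IsMarkovKernel (κ t)) : Measurable (generator κ f) :=
  measurable_of_tendsto_metrizable' (𝓝[>] (0 : ℝ≥0)) (fun t => measurable_diffQuotient hf.1 t)
    (tendsto_pi_nhds.2 fun x => hf.tendstoUniformly_generator.tendsto_at x)

theorem measurable_carreDuChamp {f g : S → ℝ} (hf : InDomain κ f) (hg : InDomain κ g)
    (hfg : InDomain κ fun x => f x * g x) (hκ : ∀ t, IsMarkovKernel (κ t)) :
    Measurable (carreDuChamp κ f g) :=
  ((((hfg.measurable_generator hκ).sub (hf.1.mul (hg.measurable_generator hκ))).sub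
    (hg.1.mul (hf.measurable_generator hκ))).const_mul _)

/-- The mixed second moment of the increments of `f` and `g` over a time step `t`, divided by
`t`. -/
noncomputable def incrementCov (κ : ℝ≥0 → Kernel S S) (f g : S → ℝ) (t : ℝ≥0) (x : S) : ℝ :=
  diffQuotient κ (fun y => f y * g y) t x - f x * diffQuotient κ g t x - g x * diffQuotient κ f t x

theorem integral_increment_mul_increment {f g : S → ℝ} {t : ℝ≥0} (ht : t ≠ 0) {x : S}
    [IsMarkovKernel (κ t)] (hf : Integrable f (κ t x)) (hg : Integrable g (κ t x))
    (hfg : Integrable (fun y => f y * g y) (κ t x)) :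
    ∫ y, (f y - f x) * (g y - g x) ∂(κ t x) = t * incrementCov κ f g t x := by
  have h : ∀ y, (f y - f x) * (g y - g x) = f y * g y - f y * g x - f x * g y + f x * g x :=
    fun y => by ring
  have i1 : Integrable (fun y => f y * g y - f y * g x) (κ t x) := hfg.sub (hf.mul_const _)
  have i2 : Integrable (fun y => f y * g y - f y * g x - f x * g y) (κ t x) :=
    i1.sub (hg.const_mul _)
  simp_rw [h]
  rw [integral_add i2 (integrable_const _), integral_sub i1 (hg.const_mul _),
    integral_sub hfg (hf.mul_const _),
    integral_mul_const, integral_const_mul, integral_const]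
  simp only [incrementCov, diffQuotient]
  have : (t : ℝ) ≠ 0 := by exact_mod_cast ht
  field_simp
  simp
  ring

/-- `incrementCov` tends to twice the carré du champ, uniformly up to a weight that grows linearly
in `f` and `g`. -/
theorem eventually_abs_incrementCov_sub_le {f g : S → ℝ} (hf : InDomain κ f) (hg : InDomain κ g)
    (hfg : InDomain κ fun x => f x * g x) {ε : ℝ} (hε : 0 < ε) :
    ∀ᶠ t in 𝓝[>] (0 : ℝ≥0), ∀ x,
      |incrementCov κ f g t x - 2 * carreDuChamp κ f g x| ≤ ε * (1 + |f x| + |g x|) := by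
  filter_upwards [Metric.tendstoUniformly_iff.1 hf.tendstoUniformly_generator ε hε,
    Metric.tendstoUniformly_iff.1 hg.tendstoUniformly_generator ε hε,
    Metric.tendstoUniformly_iff.1 hfg.tendstoUniformly_generator ε hε] with t h1 h2 h3 x
  have h1 := (h1 x).le
  have h2 := (h2 x).le
  have h3 := (h3 x).le
  rw [dist_comm, Real.dist_eq] at h1 h2 h3
  have : incrementCov κ f g t x - 2 * carreDuChamp κ f g x =
      (diffQuotient κ (fun y => f y * g y) t x - generator κ (fun y => f y * g y) x)
      - f x * (diffQuotient κ g t x - generator κ g x)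
      - g x * (diffQuotient κ f t x - generator κ f x) := by
    simp only [incrementCov, carreDuChamp]
    ring
  rw [this]
  refine (abs_sub _ _).trans ((add_le_add_left (abs_sub _ _) _).trans ?_)
  rw [abs_mul, abs_mul]
  nlinarith [mul_le_mul_of_nonneg_left h2 (abs_nonneg (f x)),
    mul_le_mul_of_nonneg_left h1 (abs_nonneg (g x))]

/-- Uniform convergence up to an integrable weight `w`, the form in which difference quotients
converge. -/
theorem eventually_integrable_of_abs_sub_le {ι : Type*} {l : Filter ι} {G : ι → S → ℝ}
    {H w : S → ℝ} (hG : ∀ t, Measurable (G t)) (hH : Integrable H μ) (hw : Integrable w μ)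
    (h : ∀ ε : ℝ, 0 < ε → ∀ᶠ t in l, ∀ x, |G t x - H x| ≤ ε * w x) :
    ∀ᶠ t in l, Integrable (G t) μ := by
  filter_upwards [h 1 one_pos] with t ht
  have h1 : Integrable (fun x => G t x - H x) μ :=
    hw.mono' ((hG t).aestronglyMeasurable.sub hH.1) (ae_of_all _ fun x => by simpa using ht x)
  refine (h1.add hH).congr (ae_of_all _ fun x => ?_)
  simp

theorem tendsto_integral_mul_of_abs_sub_le {ι : Type*} {l : Filter ι} {G : ι → S → ℝ}
    {H w b : S → ℝ} {C : ℝ} (hG : ∀ t, Measurable (G t)) (hH : Integrable H μ)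
    (hw : Integrable w μ)
    (h : ∀ ε : ℝ, 0 < ε → ∀ᶠ t in l, ∀ x, |G t x - H x| ≤ ε * w x)
    (hb : Measurable b) (hC : ∀ x, |b x| ≤ C) :
    Tendsto (fun t => ∫ x, b x * G t x ∂μ) l (𝓝 (∫ x, b x * H x ∂μ)) := by
  rw [Metric.tendsto_nhds]
  intro ε hε
  have hden : 0 < |C| * |∫ x, w x ∂μ| + 1 := by positivity
  filter_upwards [h (ε / (|C| * |∫ x, w x ∂μ| + 1)) (by positivity),
    eventually_integrable_of_abs_sub_le hG hH hw h] with t ht hint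
  have i1 := hint.bdd_mul hb.aestronglyMeasurable (ae_of_all _ hC)
  have i2 := hH.bdd_mul hb.aestronglyMeasurable (ae_of_all _ hC)
  set η := ε / (|C| * |∫ x, w x ∂μ| + 1) with hη
  have hη0 : 0 < η := by positivity
  rw [Real.dist_eq, ← integral_sub i1 i2]
  have hle : |∫ x, b x * G t x - b x * H x ∂μ| ≤ ∫ x, |C| * (η * w x) ∂μ := by
    rw [← Real.norm_eq_abs]
    refine norm_integral_le_of_norm_le ((hw.const_mul _).const_mul _) (ae_of_all _ fun x => ?_)
    rw [← mul_sub, norm_mul, Real.norm_eq_abs, Real.norm_eq_abs]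
    exact mul_le_mul ((hC x).trans (le_abs_self C)) (ht x) (abs_nonneg _) (abs_nonneg _)
  refine hle.trans_lt ?_
  rw [integral_const_mul, integral_const_mul]
  calc |C| * (η * ∫ x, w x ∂μ) ≤ |C| * (η * |∫ x, w x ∂μ|) := by
        gcongr; exact le_abs_self _
    _ = η * (|C| * |∫ x, w x ∂μ|) := by ring
    _ < η * (|C| * |∫ x, w x ∂μ| + 1) := by gcongr; linarith
    _ = ε := by rw [hη]; field_simp

theorem eventually_abs_diffQuotient_sub_le {f : S → ℝ} (hf : InDomain κ f) {ε : ℝ} (hε : 0 < ε) :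
    ∀ᶠ t in 𝓝[>] (0 : ℝ≥0), ∀ x, |diffQuotient κ f t x - generator κ f x| ≤ ε * 1 := by
  filter_upwards [Metric.tendstoUniformly_iff.1 hf.tendstoUniformly_generator ε hε] with t h x
  rw [mul_one, ← Real.dist_eq, dist_comm]
  exact (h x).le

theorem measurable_incrementCov {f g : S → ℝ} (hf : Measurable f) (hg : Measurable g) (t : ℝ≥0)
    [IsMarkovKernel (κ t)] : Measurable (incrementCov κ f g t) :=
  ((measurable_diffQuotient (hf.mul hg) t).sub (hf.mul (measurable_diffQuotient hg t))).sub
    (hg.mul (measurable_diffQuotient hf t))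

theorem measurePreserving_fst_compProd [IsProbabilityMeasure μ] {η : Kernel S S}
    [IsMarkovKernel η] : MeasurePreserving Prod.fst (μ ⊗ₘ η) μ :=
  ⟨measurable_fst, Measure.fst_compProd μ η⟩

theorem measurePreserving_snd_compProd [IsProbabilityMeasure μ] {η : Kernel S S}
    [IsMarkovKernel η] (h : η.IsReversible μ) : MeasurePreserving Prod.snd (μ ⊗ₘ η) μ :=
  measurePreserving_fst_compProd.comp
    (⟨measurable_swap, map_swap_compProd_of_isReversible h⟩ :
      MeasurePreserving Prod.swap (μ ⊗ₘ η) (μ ⊗ₘ η))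

/-- The generator is within distance `1` of an integrable difference quotient. -/
theorem integrable_generator [IsProbabilityMeasure μ] {f : S → ℝ} (hf : InDomain κ f)
    (hκ : ∀ t, IsMarkovKernel (κ t)) (hrev : ∀ t, (κ t).IsReversible μ) (hfi : Integrable f μ) :
    Integrable (generator κ f) μ := by
  obtain ⟨t, ht⟩ := (eventually_abs_diffQuotient_sub_le hf one_pos).exists
  have h1 : Integrable (diffQuotient κ f t) μ := by
    have h2 := (measurePreserving_snd_compProd (hrev t)).integrable_comp_of_integrable hfi
    have h2' := ((Measure.integrable_compProd_iff h2.1).1 h2).2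
    have h2'' : Integrable (fun x => ∫ y, f y ∂(κ t x)) μ :=
      h2'.mono' hf.1.stronglyMeasurable.integral_kernel.aestronglyMeasurable
        (ae_of_all _ fun x => norm_integral_le_integral_norm _)
    exact (h2''.sub hfi).div_const _
  have h3 : Integrable (fun x => diffQuotient κ f t x - generator κ f x) μ :=
    Integrable.of_bound (h1.1.sub (hf.measurable_generator hκ).aestronglyMeasurable) (1 * 1)
      (ae_of_all _ fun x => by simpa using ht x)
  refine (h1.sub h3).congr (ae_of_all _ fun x => ?_)
  simp

theorem integrable_increment_sq [IsProbabilityMeasure μ] {f : S → ℝ} {t : ℝ≥0} (ht : t ≠ 0)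
    [IsMarkovKernel (κ t)] (hfm : Measurable f) (hf : ∀ x, Integrable f (κ t x))
    (hff : ∀ x, Integrable (fun y => f y * f y) (κ t x))
    (hi : Integrable (incrementCov κ f f t) μ) :
    Integrable (fun p : S × S => (f p.2 - f p.1) ^ 2) (μ ⊗ₘ κ t) := by
  rw [Measure.integrable_compProd_iff (by fun_prop)]
  refine ⟨ae_of_all _ fun x => ?_, ?_⟩
  · have : Integrable (fun y => f y * f y - 2 * f x * f y + f x ^ 2) (κ t x) :=
      ((hff x).sub ((hf x).const_mul _)).add (integrable_const _)
    refine this.congr (ae_of_all _ fun y => ?_)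
    simp only
    ring
  · refine (hi.const_mul (t : ℝ)).congr (ae_of_all _ fun x => ?_)
    simp only
    rw [← integral_increment_mul_increment ht (hf x) (hf x) (hff x)]
    refine integral_congr_ae (ae_of_all _ fun y => ?_)
    simp only [Real.norm_eq_abs, abs_pow, sq_abs]
    ring

theorem integral_mul_increment_mul_increment [IsProbabilityMeasure μ] {f g b : S → ℝ} {t : ℝ≥0}
    (ht : t ≠ 0) [IsMarkovKernel (κ t)]
    (hf : ∀ x, Integrable f (κ t x)) (hg : ∀ x, Integrable g (κ t x))
    (hfg : ∀ x, Integrable (fun y => f y * g y) (κ t x))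
    (hi : Integrable (fun p : S × S => b p.1 * ((f p.2 - f p.1) * (g p.2 - g p.1))) (μ ⊗ₘ κ t)) :
    ∫ p, b p.1 * ((f p.2 - f p.1) * (g p.2 - g p.1)) ∂(μ ⊗ₘ κ t) =
      t * ∫ x, b x * incrementCov κ f g t x ∂μ := by
  rw [Measure.integral_compProd hi, ← integral_const_mul]
  congr 1 with x
  simp only
  rw [integral_const_mul, integral_increment_mul_increment ht (hf x) (hg x) (hfg x)]
  ring

theorem integral_mul_increment [IsProbabilityMeasure μ] {f b : S → ℝ} {t : ℝ≥0}
    (ht : t ≠ 0) [IsMarkovKernel (κ t)] (hf : ∀ x, Integrable f (κ t x))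
    (hi : Integrable (fun p : S × S => b p.1 * (f p.2 - f p.1)) (μ ⊗ₘ κ t)) :
    ∫ p, b p.1 * (f p.2 - f p.1) ∂(μ ⊗ₘ κ t) = t * ∫ x, b x * diffQuotient κ f t x ∂μ := by
  rw [Measure.integral_compProd hi, ← integral_const_mul]
  congr 1 with x
  simp only
  rw [integral_const_mul, integral_sub (hf x) (integrable_const _), integral_const]
  have : (t : ℝ) ≠ 0 := by exact_mod_cast ht
  simp only [diffQuotient]
  field_simp
  simp

end Semigroup

/-! ### The Stein identity of a reversible process -/

section Identity

/-- First order Taylor estimate for a `C¹` function with bounded derivative: the remainder is small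
relative to the increment, except for large increments and outside of a large ball. -/
theorem exists_norm_taylor_remainder_le {d : ℕ} {ψ : EuclideanSpace ℝ (Fin d) → ℝ} {C : ℝ}
    (hψ : ContDiff ℝ 1 ψ) (hC : ∀ x, ‖fderiv ℝ ψ x‖ ≤ C) {η : ℝ} (hη : 0 < η) (R : ℝ) :
    ∃ ρ > 0, ∀ x y : EuclideanSpace ℝ (Fin d), |ψ y - ψ x - fderiv ℝ ψ x (y - x)| ≤
      (η + (if ρ < ‖y - x‖ then 2 * C else 0) + (if R < ‖x‖ then 2 * C else 0)) * ‖y - x‖ := by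
  have hd : Differentiable ℝ ψ := hψ.differentiable one_ne_zero
  have hC0 : 0 ≤ C := (norm_nonneg _).trans (hC 0)
  have hrem : ∀ (c : ℝ) (x y : EuclideanSpace ℝ (Fin d)),
      (∀ z ∈ segment ℝ x y, ‖fderiv ℝ ψ z - fderiv ℝ ψ x‖ ≤ c) →
      |ψ y - ψ x - fderiv ℝ ψ x (y - x)| ≤ c * ‖y - x‖ := fun c x y h => by
    rw [← Real.norm_eq_abs]
    exact (convex_segment x y).norm_image_sub_le_of_norm_fderiv_le' (fun z _ => hd z) h
      (left_mem_segment ℝ x y) (right_mem_segment ℝ x y)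
  have huc : UniformContinuousOn (fderiv ℝ ψ) (Metric.closedBall 0 (R + 1)) :=
    (isCompact_closedBall _ _).uniformContinuousOn_of_continuous
      (hψ.continuous_fderiv one_ne_zero).continuousOn
  obtain ⟨ρ, hρ, h⟩ := Metric.uniformContinuousOn_iff.1 huc η hη
  refine ⟨min (ρ / 2) 1, by positivity, fun x y => ?_⟩
  by_cases h1 : min (ρ / 2) 1 < ‖y - x‖ ∨ R < ‖x‖
  · refine (hrem (2 * C) x y fun z _ => ?_).trans ?_
    · exact (norm_sub_le _ _).trans (by linarith [hC z, hC x])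
    · gcongr
      rcases h1 with h1 | h1
      · rw [if_pos h1]
        split_ifs <;> linarith
      · rw [if_pos h1]
        split_ifs <;> linarith
  · push Not at h1
    rw [if_neg h1.1.not_gt, if_neg h1.2.not_gt, add_zero, add_zero]
    refine hrem η x y fun z hz => ?_
    have hzx : ‖z - x‖ ≤ ‖y - x‖ := by
      have := (convex_closedBall x ‖y - x‖).segment_subset (by simp)
        (by simp [dist_eq_norm]) hz
      simpa [dist_eq_norm] using this
    have hz1 := hzx.trans h1.1
    rw [← dist_eq_norm]
    refine (h z ?_ x ?_ ?_).le
    · rw [mem_closedBall_zero_iff]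
      calc ‖z‖ = ‖x + (z - x)‖ := by congr 1; abel
        _ ≤ ‖x‖ + ‖z - x‖ := norm_add_le _ _
        _ ≤ R + 1 := add_le_add h1.2 (hz1.trans (min_le_right _ _))
    · rw [mem_closedBall_zero_iff]
      linarith [h1.2]
    · rw [dist_eq_norm]
      linarith [hz1.trans (min_le_left _ _)]

variable {S : Type*} [MeasurableSpace S] {μ : Measure S} {κ : ℝ≥0 → Kernel S S} {d : ℕ}
  {F : S → EuclideanSpace ℝ (Fin d)}

/-- The small-time covariances converge when weighted with a bounded function. -/
theorem tendsto_integral_mul_incrementCov [IsProbabilityMeasure μ] (hκ : ∀ t, IsMarkovKernel (κ t))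
    {f g b : S → ℝ} (hf : InDomain κ f) (hg : InDomain κ g)
    (hfg : InDomain κ fun x => f x * g x) (hfi : Integrable f μ) (hgi : Integrable g μ)
    (hΓ : Integrable (carreDuChamp κ f g) μ) {C : ℝ} (hb : Measurable b) (hC : ∀ x, |b x| ≤ C) :
    Tendsto (fun t => ∫ x, b x * incrementCov κ f g t x ∂μ) (𝓝[>] 0)
      (𝓝 (∫ x, b x * (2 * carreDuChamp κ f g x) ∂μ)) :=
  tendsto_integral_mul_of_abs_sub_le (w := fun x => 1 + |f x| + |g x|)
    (fun t => measurable_incrementCov hf.1 hg.1 t) (hΓ.const_mul 2)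
    (((integrable_const _).add hfi.abs).add hgi.abs)
    (fun _ hε => eventually_abs_incrementCov_sub_le hf hg hfg hε) hb hC

/-- For small `t > 0` the conditional expectations exist and the increments are square integrable
under the joint law `μ ⊗ₘ κ t`. -/
theorem eventually_integrable_norm_increment_sq [IsProbabilityMeasure μ]
    (hκ : ∀ t, IsMarkovKernel (κ t))
    (hF : ∀ j, InDomain κ (fun x => F x j))
    (hFF : ∀ j k, InDomain κ (fun x => F x j * F x k)) (hFint : Integrable F μ)
    (hΓ : ∀ j, Integrable (carreDuChamp κ (fun y => F y j) (fun y => F y j)) μ) :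
    ∀ᶠ t in 𝓝[>] (0 : ℝ≥0), t ≠ 0 ∧ (∀ j x, Integrable (fun y => F y j) (κ t x)) ∧
      (∀ j k x, Integrable (fun y => F y j * F y k) (κ t x)) ∧
      Integrable (fun p : S × S => ‖F p.2 - F p.1‖ ^ 2) (μ ⊗ₘ κ t) := by
  have hFi : ∀ j, Integrable (fun x => F x j) μ := fun j =>
    (EuclideanSpace.proj (𝕜 := ℝ) j).integrable_comp hFint
  have h0 : ∀ᶠ t in 𝓝[>] (0 : ℝ≥0), t ≠ 0 :=
    (eventually_mem_nhdsWithin).mono fun t (ht : 0 < t) => ht.ne'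
  have h1 := eventually_all.2 fun j => (hF j).2.1
  have h2 := eventually_all.2 fun j => eventually_all.2 fun k => (hFF j k).2.1
  have h3 : ∀ᶠ t in 𝓝[>] (0 : ℝ≥0), ∀ j,
      Integrable (incrementCov κ (fun x => F x j) (fun x => F x j) t) μ :=
    eventually_all.2 fun j => eventually_integrable_of_abs_sub_le
      (w := fun x => 1 + |F x j| + |F x j|)
      (fun t => measurable_incrementCov (hF j).1 (hF j).1 t) ((hΓ j).const_mul 2)
      (((integrable_const _).add (hFi j).abs).add (hFi j).abs)
      (fun _ hε => eventually_abs_incrementCov_sub_le (hF j) (hF j) (hFF j j) hε)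
  filter_upwards [h0, h1, h2, h3] with t ht h1 h2 h3
  refine ⟨ht, h1, h2, ?_⟩
  simp only [EuclideanSpace.real_norm_sq_eq]
  exact integrable_finsetSum _ fun j _ =>
    integrable_increment_sq ht (hF j).1 (h1 j) (h2 j j) (h3 j)

theorem measurable_of_inDomain_coord (hF : ∀ j, InDomain κ (fun x => F x j)) : Measurable F :=
  (WithLp.measurable_toLp 2 (Fin d → ℝ)).comp (measurable_pi_lambda _ fun j => (hF j).1)

theorem integral_mul_coord_increments [IsProbabilityMeasure μ] {t : ℝ≥0} (ht : t ≠ 0)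
    [IsMarkovKernel (κ t)] (hF : Measurable F)
    (h1 : ∀ j x, Integrable (fun y => F y j) (κ t x))
    (h2 : ∀ j k x, Integrable (fun y => F y j * F y k) (κ t x))
    (h3 : Integrable (fun p : S × S => ‖F p.2 - F p.1‖ ^ 2) (μ ⊗ₘ κ t))
    {b : S → ℝ} {C : ℝ} (hb : Measurable b) (hC : ∀ x, |b x| ≤ C) (j k : Fin d) :
    Integrable (fun p : S × S => b p.1 * ((F p.2 j - F p.1 j) * (F p.2 k - F p.1 k))) (μ ⊗ₘ κ t) ∧
    ∫ p, b p.1 * ((F p.2 j - F p.1 j) * (F p.2 k - F p.1 k)) ∂(μ ⊗ₘ κ t) =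
      t * ∫ x, b x * incrementCov κ (fun y => F y j) (fun y => F y k) t x ∂μ := by
  have hFm : ∀ j, Measurable fun x => F x j := fun j =>
    (EuclideanSpace.proj (𝕜 := ℝ) j).continuous.measurable.comp hF
  have hi : Integrable (fun p : S × S => b p.1 * ((F p.2 j - F p.1 j) * (F p.2 k - F p.1 k)))
      (μ ⊗ₘ κ t) := by
    refine Integrable.bdd_mul (c := C) ?_ (hb.comp measurable_fst).aestronglyMeasurable
      (ae_of_all _ fun p => hC _)
    refine h3.mono' (by fun_prop) (ae_of_all _ fun p => ?_)
    rw [norm_mul, sq]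
    exact mul_le_mul (PiLp.norm_apply_le (F p.2 - F p.1) j) (PiLp.norm_apply_le (F p.2 - F p.1) k)
      (norm_nonneg _) (norm_nonneg _)
  exact ⟨hi, integral_mul_increment_mul_increment ht (h1 j) (h1 k) (h2 j k) hi⟩

/-- The Taylor remainder is negligible at first order in `t`; this is where the Lindeberg condition
enters. -/
theorem tendsto_inv_mul_integral_increment_mul_remainder [IsProbabilityMeasure μ]
    (hκ : ∀ t, IsMarkovKernel (κ t))
    (hF : ∀ j, InDomain κ (fun x => F x j))
    (hFF : ∀ j k, InDomain κ (fun x => F x j * F x k)) (hFint : Integrable F μ)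
    (hΓ : ∀ j k, Integrable (carreDuChamp κ (fun y => F y j) (fun y => F y k)) μ)
    (hLind : ∀ ρ : ℝ, 0 < ρ → Tendsto (fun t : ℝ≥0 => (t : ℝ)⁻¹ *
      ∫ p : S × S, (if ρ < ‖F p.2 - F p.1‖ then ‖F p.2 - F p.1‖ ^ 2 else 0) ∂(μ ⊗ₘ κ t))
      (𝓝[>] 0) (𝓝 0))
    {ψ : EuclideanSpace ℝ (Fin d) → ℝ} {C : ℝ}
    (hψ : ContDiff ℝ 1 ψ) (hC : ∀ x, ‖fderiv ℝ ψ x‖ ≤ C) (j : Fin d) :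
    Tendsto (fun t : ℝ≥0 => (t : ℝ)⁻¹ * ∫ p : S × S, (F p.2 j - F p.1 j) *
      (ψ (F p.2) - ψ (F p.1) - fderiv ℝ ψ (F p.1) (F p.2 - F p.1)) ∂(μ ⊗ₘ κ t))
      (𝓝[>] 0) (𝓝 0) := by
  have hFm : Measurable F := measurable_of_inDomain_coord hF
  have hC0 : 0 ≤ C := (norm_nonneg _).trans (hC 0)
  have hFi : ∀ j, Integrable (fun x => F x j) μ := fun j =>
    (EuclideanSpace.proj (𝕜 := ℝ) j).integrable_comp hFint
  set T : S → ℝ := fun x => ∑ i, 2 * carreDuChamp κ (fun y => F y i) (fun y => F y i) x with hT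
  have hTi : Integrable T μ := integrable_finsetSum _ fun i _ => (hΓ i i).const_mul 2
  have hgood := eventually_integrable_norm_increment_sq hκ hF hFF hFint fun i => hΓ i i
  have hlim : ∀ b : S → ℝ, Measurable b → (∀ x, |b x| ≤ 1) →
      Tendsto (fun t : ℝ≥0 => (t : ℝ)⁻¹ * ∫ p : S × S, b p.1 * ‖F p.2 - F p.1‖ ^ 2 ∂(μ ⊗ₘ κ t))
        (𝓝[>] 0) (𝓝 (∫ x, b x * T x ∂μ)) := fun b hb hb1 => by
    have hsum : Tendsto (fun t : ℝ≥0 => ∑ i, ∫ x, b x *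
        incrementCov κ (fun y => F y i) (fun y => F y i) t x ∂μ) (𝓝[>] 0)
        (𝓝 (∑ i, ∫ x, b x * (2 * carreDuChamp κ (fun y => F y i) (fun y => F y i) x) ∂μ)) :=
      tendsto_finsetSum _ fun i _ => tendsto_integral_mul_incrementCov hκ (hF i) (hF i) (hFF i i)
        (hFi i) (hFi i) (hΓ i i) hb hb1
    have hTe : ∫ x, b x * T x ∂μ =
        ∑ i, ∫ x, b x * (2 * carreDuChamp κ (fun y => F y i) (fun y => F y i) x) ∂μ := by
      rw [← integral_finsetSum _ fun i _ => ((hΓ i i).const_mul 2).bdd_mul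
        hb.aestronglyMeasurable (ae_of_all _ hb1)]
      simp only [hT, Finset.mul_sum]
    rw [hTe]
    refine hsum.congr' ?_
    filter_upwards [hgood] with t ⟨ht, h1, h2, h3⟩
    have := hκ t
    have hb' := fun i => integral_mul_coord_increments ht hFm h1 h2 h3 hb hb1 i i
    have hte : (t : ℝ) ≠ 0 := by exact_mod_cast ht
    have : ∀ p : S × S, b p.1 * ‖F p.2 - F p.1‖ ^ 2 =
        ∑ i, b p.1 * ((F p.2 i - F p.1 i) * (F p.2 i - F p.1 i)) := fun p => by
      rw [EuclideanSpace.real_norm_sq_eq, Finset.mul_sum]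
      simp [sq]
    simp_rw [this]
    rw [integral_finsetSum _ fun i _ => (hb' i).1, Finset.mul_sum]
    refine Finset.sum_congr rfl fun i _ => ?_
    rw [(hb' i).2]
    field_simp
  rw [Metric.tendsto_nhds]
  intro ε hε
  set K := ∫ x, 1 * T x ∂μ with hK
  -- `K` is the limit of `𝔼 ‖δ‖² / t`, with `δ = F(X_t) - F(X₀)`; hence `η ‖δ‖²` contributes `ε / 4`
  set η := ε / (4 * (|K| + 1)) with hη
  have hη0 : 0 < η := by positivity
  have hR : ∃ R : ℕ, 2 * C * ∫ x, (if (R : ℝ) < ‖F x‖ then 1 else 0) * T x ∂μ < ε / 4 := by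
    have h0 : Tendsto (fun R : ℕ => ∫ x, (if (R : ℝ) < ‖F x‖ then 1 else 0) * T x ∂μ) atTop
        (𝓝 (∫ _, (0 : ℝ) ∂μ)) := by
      refine tendsto_integral_of_dominated_convergence (fun x => ‖T x‖) (fun R => ?_) hTi.norm
        (fun R => ae_of_all _ fun x => ?_) (ae_of_all _ fun x => ?_)
      · exact (Measurable.ite (measurableSet_lt measurable_const hFm.norm) measurable_const
          measurable_const).aestronglyMeasurable.mul hTi.1
      · split_ifs <;> simp
      · refine tendsto_const_nhds.congr' ?_
        filter_upwards [eventually_ge_atTop ⌈‖F x‖⌉₊] with R hR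
        rw [if_neg (not_lt.2 (Nat.ceil_le.1 hR)), zero_mul]
    have h0' := h0.const_mul (2 * C)
    rw [integral_zero, mul_zero] at h0'
    exact ((tendsto_order.1 h0').2 (ε / 4) (by positivity)).exists
  obtain ⟨R, hR⟩ := hR
  -- `ρ` comes from the uniform continuity of the derivative of `ψ` on the ball of radius `R + 1`
  obtain ⟨ρ, hρ, hrem⟩ := exists_norm_taylor_remainder_le hψ hC hη0 R
  have l1 := (tendsto_order.1 (hlim (fun _ => 1) measurable_const (by simp))).2 (|K| + 1)
    ((le_abs_self K).trans_lt (lt_add_one _))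
  have hbR : Measurable fun x => if (R : ℝ) < ‖F x‖ then (1 : ℝ) else 0 :=
    Measurable.ite (measurableSet_lt measurable_const hFm.norm) measurable_const measurable_const
  have l2 := (tendsto_order.1 ((hlim (fun x => if (R : ℝ) < ‖F x‖ then 1 else 0) hbR
    (fun x => by split_ifs <;> simp)).const_mul (2 * C))).2 (ε / 4) hR
  have l3 := (tendsto_order.1 ((hLind ρ hρ).const_mul (2 * C))).2 (ε / 4)
    (by rw [mul_zero]; positivity)
  filter_upwards [hgood, l1, l2, l3] with t ⟨ht, h1, h2, h3⟩ l1 l2 l3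
  have htpos : (0 : ℝ) < t := by exact_mod_cast pos_iff_ne_zero.2 ht
  have := hκ t
  have i1 : Integrable (fun p : S × S => 1 * ‖F p.2 - F p.1‖ ^ 2) (μ ⊗ₘ κ t) := by simpa using h3
  have i2 : Integrable (fun p : S × S =>
      (if (R : ℝ) < ‖F p.1‖ then 1 else 0) * ‖F p.2 - F p.1‖ ^ 2) (μ ⊗ₘ κ t) :=
    h3.bdd_mul (c := 1) (hbR.comp measurable_fst).aestronglyMeasurable
      (ae_of_all _ fun p => by split_ifs <;> simp)
  have i3 : Integrable (fun p : S × S =>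
      if ρ < ‖F p.2 - F p.1‖ then ‖F p.2 - F p.1‖ ^ 2 else 0) (μ ⊗ₘ κ t) := by
    refine h3.mono' (Measurable.ite (measurableSet_lt measurable_const (by fun_prop))
      (by fun_prop) measurable_const).aestronglyMeasurable (ae_of_all _ fun p => ?_)
    split_ifs
    · simp
    · simp
  rw [dist_zero_right, norm_mul, norm_inv, Real.norm_of_nonneg htpos.le]
  have i4 : Integrable (fun p : S × S => η * (1 * ‖F p.2 - F p.1‖ ^ 2) +
      2 * C * (if ρ < ‖F p.2 - F p.1‖ then ‖F p.2 - F p.1‖ ^ 2 else 0)) (μ ⊗ₘ κ t) :=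
    (i1.const_mul η).add (i3.const_mul _)
  have hbd : ‖∫ p : S × S, (F p.2 j - F p.1 j) *
      (ψ (F p.2) - ψ (F p.1) - fderiv ℝ ψ (F p.1) (F p.2 - F p.1)) ∂(μ ⊗ₘ κ t)‖ ≤
      ∫ p : S × S, (η * (1 * ‖F p.2 - F p.1‖ ^ 2) +
        2 * C * (if ρ < ‖F p.2 - F p.1‖ then ‖F p.2 - F p.1‖ ^ 2 else 0)) +
        2 * C * ((if (R : ℝ) < ‖F p.1‖ then 1 else 0) * ‖F p.2 - F p.1‖ ^ 2) ∂(μ ⊗ₘ κ t) := by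
    refine norm_integral_le_of_norm_le
      (i4.add (i2.const_mul _)) (ae_of_all _ fun p => ?_)
    rw [norm_mul, Real.norm_eq_abs (ψ _ - _ - _)]
    refine (mul_le_mul (PiLp.norm_apply_le (F p.2 - F p.1) j) (hrem (F p.1) (F p.2))
      (abs_nonneg _) (norm_nonneg _)).trans (le_of_eq ?_)
    split_ifs <;> ring
  rw [integral_add i4 (i2.const_mul _), integral_add (i1.const_mul η) (i3.const_mul _),
    integral_const_mul η,
    integral_const_mul (2 * C), integral_const_mul (2 * C)] at hbd
  have hfin := mul_le_mul_of_nonneg_left hbd (inv_pos.2 htpos).le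
  refine hfin.trans_lt ?_
  have hηK : η * (|K| + 1) = ε / 4 := by rw [hη]; field_simp
  have l1' := mul_lt_mul_of_pos_left l1 hη0
  rw [hηK] at l1'
  calc _ = η * ((t : ℝ)⁻¹ * ∫ p : S × S, 1 * ‖F p.2 - F p.1‖ ^ 2 ∂(μ ⊗ₘ κ t)) +
        2 * C * ((t : ℝ)⁻¹ * ∫ p : S × S,
          (if ρ < ‖F p.2 - F p.1‖ then ‖F p.2 - F p.1‖ ^ 2 else 0) ∂(μ ⊗ₘ κ t)) +
        2 * C * ((t : ℝ)⁻¹ * ∫ p : S × S,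
          (if (R : ℝ) < ‖F p.1‖ then 1 else 0) * ‖F p.2 - F p.1‖ ^ 2 ∂(μ ⊗ₘ κ t)) := by ring
    _ < ε := by linarith

/-- **Stein identity of a reversible process.** The expectation of
`(F_j(X_t) - F_j(X_0)) (ψ(F(X_t)) + ψ(F(X_0)))` vanishes by reversibility; its expansion at first
order in `t` gives the identity. -/
theorem integral_generator_add_carreDuChamp_eq_zero [IsProbabilityMeasure μ]
    (hκ : ∀ t, IsMarkovKernel (κ t)) (hrev : ∀ t, (κ t).IsReversible μ)
    (hF : ∀ j, InDomain κ (fun x => F x j))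
    (hFF : ∀ j k, InDomain κ (fun x => F x j * F x k)) (hFint : Integrable F μ)
    (hΓ : ∀ j k, Integrable (carreDuChamp κ (fun y => F y j) (fun y => F y k)) μ)
    (hLind : ∀ ρ : ℝ, 0 < ρ → Tendsto (fun t : ℝ≥0 => (t : ℝ)⁻¹ *
      ∫ p : S × S, (if ρ < ‖F p.2 - F p.1‖ then ‖F p.2 - F p.1‖ ^ 2 else 0) ∂(μ ⊗ₘ κ t))
      (𝓝[>] 0) (𝓝 0))
    {ψ : EuclideanSpace ℝ (Fin d) → ℝ} {C₀ C : ℝ}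
    (hψ : ContDiff ℝ 1 ψ) (hC₀ : ∀ x, |ψ x| ≤ C₀) (hC : ∀ x, ‖fderiv ℝ ψ x‖ ≤ C) (j : Fin d) :
    ∫ x, ψ (F x) * generator κ (fun y => F y j) x ∂μ +
      ∑ k, ∫ x, fderiv ℝ ψ (F x) (EuclideanSpace.single k 1) *
        carreDuChamp κ (fun y => F y j) (fun y => F y k) x ∂μ = 0 := by
  have hFm : Measurable F := measurable_of_inDomain_coord hF
  have hFi : ∀ j, Integrable (fun x => F x j) μ := fun j =>
    (EuclideanSpace.proj (𝕜 := ℝ) j).integrable_comp hFint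
  have hψF : Measurable fun x => ψ (F x) := hψ.continuous.measurable.comp hFm
  have hDm : ∀ k, Measurable fun x => fderiv ℝ ψ (F x) (EuclideanSpace.single k 1) := fun k =>
    ((hψ.continuous_fderiv one_ne_zero).clm_apply continuous_const).measurable.comp hFm
  have hDb : ∀ k x, |fderiv ℝ ψ (F x) (EuclideanSpace.single k 1)| ≤ C := fun k x => by
    have := (fderiv ℝ ψ (F x)).le_opNorm (EuclideanSpace.single k 1)
    rw [Real.norm_eq_abs, PiLp.norm_single, norm_one, mul_one] at this
    exact this.trans (hC _)
  have t1 := tendsto_inv_mul_integral_increment_mul_remainder hκ hF hFF hFint hΓ hLind hψ hC j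
  have t2 : Tendsto (fun t : ℝ≥0 => ∑ k, ∫ x, fderiv ℝ ψ (F x) (EuclideanSpace.single k 1) *
      incrementCov κ (fun y => F y j) (fun y => F y k) t x ∂μ) (𝓝[>] 0)
      (𝓝 (∑ k, ∫ x, fderiv ℝ ψ (F x) (EuclideanSpace.single k 1) *
        (2 * carreDuChamp κ (fun y => F y j) (fun y => F y k) x) ∂μ)) :=
    tendsto_finsetSum _ fun k _ => tendsto_integral_mul_incrementCov hκ (hF j) (hF k) (hFF j k)
      (hFi j) (hFi k) (hΓ j k) (hDm k) (hDb k)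
  have t3 : Tendsto (fun t : ℝ≥0 => ∫ x, ψ (F x) * diffQuotient κ (fun y => F y j) t x ∂μ)
      (𝓝[>] 0) (𝓝 (∫ x, ψ (F x) * generator κ (fun y => F y j) x ∂μ)) :=
    tendsto_integral_mul_of_abs_sub_le (w := fun _ => 1)
      (fun t => measurable_diffQuotient (hF j).1 t) (integrable_generator (hF j) hκ hrev (hFi j))
      (integrable_const _) (fun ε hε => eventually_abs_diffQuotient_sub_le (hF j) hε) hψF
      (fun x => hC₀ _)
  have hev : ∀ᶠ t : ℝ≥0 in 𝓝[>] 0, (0 : ℝ) = (t : ℝ)⁻¹ * (∫ p : S × S, (F p.2 j - F p.1 j) *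
      (ψ (F p.2) - ψ (F p.1) - fderiv ℝ ψ (F p.1) (F p.2 - F p.1)) ∂(μ ⊗ₘ κ t)) +
      (∑ k, ∫ x, fderiv ℝ ψ (F x) (EuclideanSpace.single k 1) *
        incrementCov κ (fun y => F y j) (fun y => F y k) t x ∂μ) +
      2 * ∫ x, ψ (F x) * diffQuotient κ (fun y => F y j) t x ∂μ := by
    filter_upwards [eventually_integrable_norm_increment_sq hκ hF hFF hFint fun i => hΓ i i] with
      t ⟨ht, h1, h2, h3⟩
    have := hκ t
    have hte : (t : ℝ) ≠ 0 := by exact_mod_cast ht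
    have hFj : Measurable fun x => F x j := (hF j).1
    have iδ : Integrable (fun p : S × S => F p.2 j - F p.1 j) (μ ⊗ₘ κ t) :=
      ((measurePreserving_snd_compProd (hrev t)).integrable_comp_of_integrable (hFi j)).sub
        (measurePreserving_fst_compProd.integrable_comp_of_integrable (hFi j))
    have iψ1 : Integrable (fun p : S × S => ψ (F p.1) * (F p.2 j - F p.1 j)) (μ ⊗ₘ κ t) :=
      iδ.bdd_mul (c := C₀) (hψF.comp measurable_fst).aestronglyMeasurable
        (ae_of_all _ fun p => hC₀ _)
    have iψ2 : Integrable (fun p : S × S => ψ (F p.2) * (F p.2 j - F p.1 j)) (μ ⊗ₘ κ t) :=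
      iδ.bdd_mul (c := C₀) (hψF.comp measurable_snd).aestronglyMeasurable
        (ae_of_all _ fun p => hC₀ _)
    -- exchanging the two states, which leaves the joint law invariant, reverses the sign
    have hanti : ∫ p : S × S, ψ (F p.2) * (F p.2 j - F p.1 j) ∂(μ ⊗ₘ κ t) =
        -∫ p : S × S, ψ (F p.1) * (F p.2 j - F p.1 j) ∂(μ ⊗ₘ κ t) := by
      conv_lhs => rw [← map_swap_compProd_of_isReversible (hrev t)]
      rw [integral_map measurable_swap.aemeasurable, ← integral_neg]
      · congr 1 with p
        simp only [Prod.fst_swap, Prod.snd_swap]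
        ring
      · rw [map_swap_compProd_of_isReversible (hrev t)]
        exact iψ2.1
    have hq := fun k => integral_mul_coord_increments ht hFm h1 h2 h3 (hDm k) (hDb k) j k
    have hexp : ∀ p : S × S, (F p.2 j - F p.1 j) *
        (ψ (F p.2) - ψ (F p.1) - fderiv ℝ ψ (F p.1) (F p.2 - F p.1)) =
        ψ (F p.2) * (F p.2 j - F p.1 j) - ψ (F p.1) * (F p.2 j - F p.1 j) -
        ∑ k, fderiv ℝ ψ (F p.1) (EuclideanSpace.single k 1) *
          ((F p.2 j - F p.1 j) * (F p.2 k - F p.1 k)) := fun p => by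
      have hlin : fderiv ℝ ψ (F p.1) (F p.2 - F p.1) =
          ∑ k, (F p.2 k - F p.1 k) * fderiv ℝ ψ (F p.1) (EuclideanSpace.single k 1) := by
        conv_lhs => rw [← (EuclideanSpace.basisFun (Fin d) ℝ).sum_repr (F p.2 - F p.1)]
        simp [map_sum]
      rw [hlin, mul_sub, Finset.mul_sum]
      congr 1
      · ring
      · exact Finset.sum_congr rfl fun k _ => by ring
    simp_rw [hexp]
    have i12 : Integrable (fun p : S × S => ψ (F p.2) * (F p.2 j - F p.1 j) -
        ψ (F p.1) * (F p.2 j - F p.1 j)) (μ ⊗ₘ κ t) := iψ2.sub iψ1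
    rw [integral_sub i12 (integrable_finsetSum _ fun k _ => (hq k).1),
      integral_sub iψ2 iψ1, integral_finsetSum _ fun k _ => (hq k).1, hanti,
      integral_mul_increment (b := fun x => ψ (F x)) (f := fun x => F x j) ht (h1 j) iψ1]
    simp_rw [fun k => (hq k).2]
    rw [← Finset.mul_sum]
    field_simp
    ring
  have hlim := ((t1.add t2).add (t3.const_mul 2)).congr' (hev.mono fun t h => h.symm)
  have hz := tendsto_nhds_unique hlim tendsto_const_nhds
  have h2 : ∀ k, ∫ x, fderiv ℝ ψ (F x) (EuclideanSpace.single k 1) *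
        (2 * carreDuChamp κ (fun y => F y j) (fun y => F y k) x) ∂μ =
      2 * ∫ x, fderiv ℝ ψ (F x) (EuclideanSpace.single k 1) *
        carreDuChamp κ (fun y => F y j) (fun y => F y k) x ∂μ := fun k => by
    rw [← integral_const_mul]
    congr 1 with x
    ring
  simp_rw [h2, ← Finset.mul_sum] at hz
  linarith

end Identity

/-! ### Hilbert-Schmidt and operator norms -/

section Norms

variable {d : ℕ}

theorem hsNorm_nonneg (A : Matrix (Fin d) (Fin d) ℝ) : 0 ≤ hsNorm A := Real.sqrt_nonneg _

theorem hsNorm_sq (A : Matrix (Fin d) (Fin d) ℝ) : hsNorm A ^ 2 = ∑ j, ∑ k, A j k ^ 2 :=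
  Real.sq_sqrt (Finset.sum_nonneg fun _ _ => Finset.sum_nonneg fun _ _ => sq_nonneg _)

theorem hsNorm_transpose (A : Matrix (Fin d) (Fin d) ℝ) : hsNorm A.transpose = hsNorm A := by
  simp only [hsNorm, Matrix.transpose_apply]
  rw [Finset.sum_comm]

theorem opNorm_nonneg (A : Matrix (Fin d) (Fin d) ℝ) : 0 ≤ opNorm A := norm_nonneg _

theorem abs_entry_le_hsNorm (A : Matrix (Fin d) (Fin d) ℝ) (j k : Fin d) : |A j k| ≤ hsNorm A := by
  refine Real.abs_le_sqrt ?_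
  exact (Finset.single_le_sum (f := fun k => A j k ^ 2) (fun _ _ => sq_nonneg _)
    (Finset.mem_univ k)).trans (Finset.single_le_sum (f := fun j => ∑ k, A j k ^ 2)
    (fun _ _ => Finset.sum_nonneg fun _ _ => sq_nonneg _) (Finset.mem_univ j))

theorem abs_sum_mul_le_hsNorm_mul_hsNorm (A B : Matrix (Fin d) (Fin d) ℝ) :
    |∑ j, ∑ k, A j k * B j k| ≤ hsNorm A * hsNorm B := by
  refine abs_le_of_sq_le_sq ?_ (mul_nonneg (hsNorm_nonneg A) (hsNorm_nonneg B))
  rw [mul_pow, hsNorm_sq, hsNorm_sq]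
  simp only [← Finset.sum_product']
  exact Finset.sum_mul_sq_le_sq_mul_sq _ _ _

theorem hsNorm_mul_le (A B : Matrix (Fin d) (Fin d) ℝ) : hsNorm (A * B) ≤ opNorm A * hsNorm B := by
  refine Real.sqrt_le_iff.2 ⟨mul_nonneg (opNorm_nonneg A) (hsNorm_nonneg B), ?_⟩
  rw [mul_pow, hsNorm_sq, Finset.sum_comm, Finset.sum_comm (f := fun j k => B j k ^ 2),
    Finset.mul_sum]
  refine Finset.sum_le_sum fun k _ => ?_
  have h := (Matrix.toEuclideanCLM (n := Fin d) (𝕜 := ℝ) A).le_opNorm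
    (WithLp.toLp 2 fun j => B j k)
  have h2 := pow_le_pow_left₀ (norm_nonneg _) h 2
  rw [mul_pow, EuclideanSpace.real_norm_sq_eq, EuclideanSpace.real_norm_sq_eq] at h2
  exact h2

theorem hsNorm_mul_le' (A B : Matrix (Fin d) (Fin d) ℝ) : hsNorm (A * B.transpose) ≤
    opNorm B * hsNorm A := by
  rw [← hsNorm_transpose, Matrix.transpose_mul, Matrix.transpose_transpose, ← hsNorm_transpose A]
  exact hsNorm_mul_le _ _

theorem toEuclideanCLM_apply_coord (A : Matrix (Fin d) (Fin d) ℝ) (v : EuclideanSpace ℝ (Fin d))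
    (i : Fin d) : Matrix.toEuclideanCLM (n := Fin d) (𝕜 := ℝ) A v i = ∑ j, A i j * v j := rfl

end Norms

/-! ### The Stein operator of the Gaussian target -/

section SteinBound

variable {S : Type*} [MeasurableSpace S] {d : ℕ}

/-- The Jacobian matrix of the vector field with components `φ i`. -/
noncomputable def jacobian (φ : Fin d → EuclideanSpace ℝ (Fin d) → ℝ)
    (x : EuclideanSpace ℝ (Fin d)) :
    Matrix (Fin d) (Fin d) ℝ :=
  Matrix.of fun i k => fderiv ℝ (φ i) x (EuclideanSpace.single k 1)

/-- The integration by parts formula that links the drift `L = L F` and the carré du champ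
`Γ = Γ(F, F)` of a reversible process: `∫ ψ(F) L_j + ∑_k ∂_k ψ(F) Γ_jk dμ = 0` for bounded `C¹`
functions `ψ` with bounded derivative. -/
def SatisfiesSteinIdentity (μ : Measure S) (F L : S → EuclideanSpace ℝ (Fin d))
    (Γ : S → Matrix (Fin d) (Fin d) ℝ) : Prop :=
  ∀ (ψ : EuclideanSpace ℝ (Fin d) → ℝ) (C₀ C : ℝ), ContDiff ℝ 1 ψ → (∀ x, |ψ x| ≤ C₀) →
    (∀ x, ‖fderiv ℝ ψ x‖ ≤ C) → ∀ j,
    ∫ x, ψ (F x) * L x j ∂μ +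
      ∑ k, ∫ x, fderiv ℝ ψ (F x) (EuclideanSpace.single k 1) * Γ x j k ∂μ = 0

/-- Stein's method: if `L = -Λ F + E₁` and `Γ = Λ Σ + E₂`, the Stein operator of `N(0, Σ)` has
expectation controlled by the errors `E₁` and `E₂` under the law of `F`. -/
theorem abs_integral_steinOperator_le {μ : Measure S} [IsProbabilityMeasure μ]
    {F L e₁ : S → EuclideanSpace ℝ (Fin d)} {Γ e₂ : S → Matrix (Fin d) (Fin d) ℝ}
    (hid : SatisfiesSteinIdentity μ F L Γ)
    {Λ Sig : Matrix (Fin d) (Fin d) ℝ} (hΛ : IsUnit Λ)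
    (hFi : Integrable F μ) (he₁ : Integrable e₁ μ)
    (he₂ : ∀ j k, Integrable (fun x => e₂ x j k) μ)
    (hL : ∀ x, L x = -(Matrix.toEuclideanCLM (n := Fin d) (𝕜 := ℝ) Λ (F x)) + e₁ x)
    (hΓ : ∀ x, Γ x = Λ * Sig + e₂ x)
    {φ : Fin d → EuclideanSpace ℝ (Fin d) → ℝ} {B₀ B₁ C : ℝ} (hφ : ∀ i, ContDiff ℝ 1 (φ i))
    (hC : ∀ i x, ‖fderiv ℝ (φ i) x‖ ≤ C)
    (hB₀ : ∀ x, ‖(WithLp.toLp 2 fun i => φ i x : EuclideanSpace ℝ (Fin d))‖ ≤ B₀)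
    (hB₁ : ∀ x, hsNorm (jacobian φ x) ≤ B₁) :
    |∫ x, (∑ i, φ i (F x) * F x i - ∑ i, ∑ k, Sig i k * jacobian φ (F x) i k) ∂μ| ≤
      opNorm Λ⁻¹ * (B₀ * ∫ x, ‖e₁ x‖ ∂μ + B₁ * ∫ x, hsNorm (e₂ x) ∂μ) := by
  have hφb : ∀ i x, |φ i x| ≤ B₀ := fun i x =>
    (PiLp.norm_apply_le (WithLp.toLp 2 fun i => φ i x : EuclideanSpace ℝ (Fin d)) i).trans (hB₀ x)
  have hJb : ∀ i k x, |jacobian φ x i k| ≤ B₁ := fun i k x =>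
    (abs_entry_le_hsNorm _ i k).trans (hB₁ x)
  have hcoord : ∀ {G : S → EuclideanSpace ℝ (Fin d)}, Integrable G μ →
      ∀ j, Integrable (fun x => G x j) μ := fun hG j =>
    (EuclideanSpace.proj (𝕜 := ℝ) j).integrable_comp hG
  have hφm : ∀ i, AEStronglyMeasurable (fun x => φ i (F x)) μ := fun i =>
    (hφ i).continuous.comp_aestronglyMeasurable hFi.1
  have hJm : ∀ i k, AEStronglyMeasurable (fun x => jacobian φ (F x) i k) μ := fun i k =>
    (((hφ i).continuous_fderiv one_ne_zero).clm_apply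
      continuous_const).comp_aestronglyMeasurable hFi.1
  have iφ : ∀ {g : S → ℝ} (i : Fin d), Integrable g μ → Integrable (fun x => φ i (F x) * g x) μ :=
    fun i hg => hg.bdd_mul (hφm i) (ae_of_all _ fun x => hφb i _)
  have iJ : ∀ {g : S → ℝ} (i k : Fin d), Integrable g μ →
      Integrable (fun x => jacobian φ (F x) i k * g x) μ :=
    fun i k hg => hg.bdd_mul (hJm i k) (ae_of_all _ fun x => hJb i k _)
  have hΛF : Integrable (fun x => Matrix.toEuclideanCLM (n := Fin d) (𝕜 := ℝ) Λ (F x)) μ :=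
    (Matrix.toEuclideanCLM (n := Fin d) (𝕜 := ℝ) Λ).integrable_comp hFi
  have hLi : Integrable L μ := by
    rw [funext hL]
    exact hΛF.neg.add he₁
  have hΓi : ∀ j k, Integrable (fun x => Γ x j k) μ := fun j k => by
    simp only [hΓ, Matrix.add_apply]
    exact (integrable_const _).add (he₂ j k)
  have hdet : IsUnit Λ.det := (Matrix.isUnit_iff_isUnit_det Λ).1 hΛ
  -- multiplication of the identity by `Λ⁻¹`
  have hsum0 : ∀ c : Fin d → Fin d → ℝ, ∫ x, (∑ i, ∑ j, c i j * (φ i (F x) * L x j +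
      ∑ k, jacobian φ (F x) i k * Γ x j k)) ∂μ = 0 := fun c => by
    have i0 : ∀ i j, Integrable (fun x => φ i (F x) * L x j +
        ∑ k, jacobian φ (F x) i k * Γ x j k) μ := fun i j =>
      (iφ i (hcoord hLi j)).add (integrable_finsetSum _ fun k _ => iJ i k (hΓi j k))
    rw [integral_finsetSum _ fun i _ => integrable_finsetSum _ fun j _ => (i0 i j).const_mul _]
    refine Finset.sum_eq_zero fun i _ => ?_
    rw [integral_finsetSum _ fun j _ => (i0 i j).const_mul _]
    refine Finset.sum_eq_zero fun j _ => ?_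
    rw [integral_const_mul, integral_add (iφ i (hcoord hLi j))
      (integrable_finsetSum _ fun k _ => iJ i k (hΓi j k)),
      integral_finsetSum _ fun k _ => iJ i k (hΓi j k)]
    exact mul_eq_zero_of_right _ (hid (φ i) B₀ C (hφ i) (hφb i) (hC i) j)
  have hsum : ∫ x, (∑ i, ∑ j, Λ⁻¹ i j * (φ i (F x) * L x j +
      ∑ k, jacobian φ (F x) i k * Γ x j k)) ∂μ = 0 := hsum0 fun i j => Λ⁻¹ i j
  have hML : ∀ x i, ∑ j, Λ⁻¹ i j * L x j =
      -F x i + Matrix.toEuclideanCLM (n := Fin d) (𝕜 := ℝ) Λ⁻¹ (e₁ x) i := fun x i => by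
    have h1 : Matrix.toEuclideanCLM (n := Fin d) (𝕜 := ℝ) Λ⁻¹ (L x) =
        -F x + Matrix.toEuclideanCLM (n := Fin d) (𝕜 := ℝ) Λ⁻¹ (e₁ x) := by
      rw [hL, map_add, map_neg, ← ContinuousLinearMap.comp_apply, ← ContinuousLinearMap.mul_def,
        ← map_mul, Matrix.nonsing_inv_mul _ hdet, map_one]
      rfl
    rw [← toEuclideanCLM_apply_coord, h1]
    rfl
  have hMΓ : ∀ x i k, ∑ j, Λ⁻¹ i j * Γ x j k = Sig i k + (Λ⁻¹ * e₂ x) i k := fun x i k => by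
    rw [← Matrix.mul_apply, hΓ, Matrix.mul_add, ← Matrix.mul_assoc,
      Matrix.nonsing_inv_mul _ hdet, Matrix.one_mul, Matrix.add_apply]
  have hpt : ∀ x, ∑ i, ∑ j, Λ⁻¹ i j * (φ i (F x) * L x j +
      ∑ k, jacobian φ (F x) i k * Γ x j k) =
      (∑ i, φ i (F x) * Matrix.toEuclideanCLM (n := Fin d) (𝕜 := ℝ) Λ⁻¹ (e₁ x) i +
        ∑ i, ∑ k, jacobian φ (F x) i k * (Λ⁻¹ * e₂ x) i k) -
      (∑ i, φ i (F x) * F x i - ∑ i, ∑ k, Sig i k * jacobian φ (F x) i k) := fun x => by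
    have : ∀ i, ∑ j, Λ⁻¹ i j * (φ i (F x) * L x j + ∑ k, jacobian φ (F x) i k * Γ x j k) =
        φ i (F x) * ∑ j, Λ⁻¹ i j * L x j +
          ∑ k, jacobian φ (F x) i k * ∑ j, Λ⁻¹ i j * Γ x j k := fun i => by
      simp only [Finset.mul_sum, mul_add, Finset.sum_add_distrib]
      rw [Finset.sum_comm (f := fun k j => jacobian φ (F x) i k * (Λ⁻¹ i j * Γ x j k))]
      congr 1
      · exact Finset.sum_congr rfl fun j _ => by ring
      · exact Finset.sum_congr rfl fun j _ => Finset.sum_congr rfl fun k _ => by ring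
    simp only [this, hML, hMΓ]
    simp only [mul_add, Finset.sum_add_distrib, mul_neg, Finset.sum_neg_distrib]
    simp only [mul_comm (Sig _ _)]
    ring
  have iA : Integrable (fun x => ∑ i, φ i (F x) * F x i -
      ∑ i, ∑ k, Sig i k * jacobian φ (F x) i k) μ :=
    (integrable_finsetSum _ fun i _ => iφ i (hcoord hFi i)).sub
      (integrable_finsetSum _ fun i _ => integrable_finsetSum _ fun k _ => by
        simpa [mul_comm] using iJ i k (integrable_const (Sig i k)))
  have hMe₁ : Integrable (fun x => Matrix.toEuclideanCLM (n := Fin d) (𝕜 := ℝ) Λ⁻¹ (e₁ x)) μ :=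
    (Matrix.toEuclideanCLM (n := Fin d) (𝕜 := ℝ) Λ⁻¹).integrable_comp he₁
  have iB : Integrable (fun x =>
      ∑ i, φ i (F x) * Matrix.toEuclideanCLM (n := Fin d) (𝕜 := ℝ) Λ⁻¹ (e₁ x) i +
        ∑ i, ∑ k, jacobian φ (F x) i k * (Λ⁻¹ * e₂ x) i k) μ := by
    refine (integrable_finsetSum _ fun i _ => iφ i (hcoord hMe₁ i)).add
      (integrable_finsetSum _ fun i _ => integrable_finsetSum _ fun k _ => iJ i k ?_)
    simp only [Matrix.mul_apply]
    exact integrable_finsetSum _ fun j _ => (he₂ j k).const_mul _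
  simp_rw [hpt] at hsum
  rw [integral_sub iB iA, sub_eq_zero] at hsum
  have ihs : Integrable (fun x => hsNorm (e₂ x)) μ := by
    refine Integrable.mono' (integrable_finsetSum Finset.univ fun j _ =>
      integrable_finsetSum Finset.univ fun k _ => (he₂ j k).abs) ?_ (ae_of_all _ fun x => ?_)
    · refine Real.continuous_sqrt.comp_aestronglyMeasurable ?_
      exact Finset.aestronglyMeasurable_fun_sum _ fun j _ =>
        Finset.aestronglyMeasurable_fun_sum _ fun k _ => (he₂ j k).1.pow 2
    · rw [Real.norm_of_nonneg (hsNorm_nonneg _)]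
      refine Real.sqrt_le_iff.2 ⟨by positivity, ?_⟩
      simp only [← Finset.sum_product', ← sq_abs (e₂ x _ _)]
      exact Finset.sum_sq_le_sq_sum_of_nonneg fun _ _ => abs_nonneg _
  rw [← hsum, ← Real.norm_eq_abs]
  refine (norm_integral_le_of_norm_le (g := fun x => opNorm Λ⁻¹ * (B₀ * ‖e₁ x‖ +
    B₁ * hsNorm (e₂ x))) (((he₁.norm.const_mul _).add (ihs.const_mul _)).const_mul _)
    (ae_of_all _ fun x => ?_)).trans (le_of_eq ?_)
  · rw [mul_add]
    refine (norm_add_le _ _).trans (add_le_add ?_ ?_)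
    · have hin : ∑ i, φ i (F x) * Matrix.toEuclideanCLM (n := Fin d) (𝕜 := ℝ) Λ⁻¹ (e₁ x) i =
          inner ℝ (Matrix.toEuclideanCLM (n := Fin d) (𝕜 := ℝ) Λ⁻¹ (e₁ x))
            (WithLp.toLp 2 fun i => φ i (F x) : EuclideanSpace ℝ (Fin d)) := by
        simp [PiLp.inner_apply]
      rw [hin]
      refine (norm_inner_le_norm _ _).trans ?_
      calc _ ≤ (opNorm Λ⁻¹ * ‖e₁ x‖) * B₀ :=
            mul_le_mul (ContinuousLinearMap.le_opNorm _ _) (hB₀ _) (norm_nonneg _)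
              (mul_nonneg (opNorm_nonneg _) (norm_nonneg _))
        _ = _ := by ring
    · rw [Real.norm_eq_abs]
      refine (abs_sum_mul_le_hsNorm_mul_hsNorm _ _).trans ?_
      calc _ ≤ B₁ * (opNorm Λ⁻¹ * hsNorm (e₂ x)) :=
            mul_le_mul (hB₁ _) (hsNorm_mul_le _ _) (hsNorm_nonneg _)
              ((hsNorm_nonneg _).trans (hB₁ 0))
        _ = _ := by ring
  · rw [integral_const_mul, integral_add (he₁.norm.const_mul _) (ihs.const_mul _),
      integral_const_mul, integral_const_mul]

end SteinBound

/-! ### Gaussian smoothing of the gradient -/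

section Smoothing

variable {d : ℕ}

/-- Gaussian average `x ↦ 𝔼 p(s x + c A N)` of a function `p`, with `N` standard Gaussian. -/
noncomputable def gaussianAverage (A : Matrix (Fin d) (Fin d) ℝ) (s c : ℝ)
    (p : EuclideanSpace ℝ (Fin d) → ℝ)
    (x : EuclideanSpace ℝ (Fin d)) : ℝ :=
  ∫ n, p (s • x + c • Matrix.toEuclideanCLM (n := Fin d) (𝕜 := ℝ) A n)
    ∂(stdGaussian (EuclideanSpace ℝ (Fin d)))

/-- The partial derivative `∂_i g`. -/
noncomputable def partialDeriv (g : EuclideanSpace ℝ (Fin d) → ℝ) (i : Fin d)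
    (x : EuclideanSpace ℝ (Fin d)) :
    ℝ :=
  fderiv ℝ g x (EuclideanSpace.single i 1)

theorem clm_apply_eq_sum (l : EuclideanSpace ℝ (Fin d) →L[ℝ] ℝ) (v : EuclideanSpace ℝ (Fin d)) :
    l v = ∑ k, v k * l (EuclideanSpace.single k 1) := by
  conv_lhs => rw [← (EuclideanSpace.basisFun (Fin d) ℝ).sum_repr v]
  simp [map_sum]

theorem abs_apply_single_le (l : EuclideanSpace ℝ (Fin d) →L[ℝ] ℝ) (k : Fin d) :
    |l (EuclideanSpace.single k 1)| ≤ ‖l‖ := by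
  have := l.le_opNorm (EuclideanSpace.single k 1)
  rwa [Real.norm_eq_abs, PiLp.norm_single, norm_one, mul_one] at this

theorem integrable_bounded_comp {p : EuclideanSpace ℝ (Fin d) → ℝ} {C₀ : ℝ} (hp : Continuous p)
    (h₀ : ∀ x, |p x| ≤ C₀) {q : EuclideanSpace ℝ (Fin d) → EuclideanSpace ℝ (Fin d)}
    (hq : Continuous q) :
    Integrable (fun n => p (q n)) (stdGaussian (EuclideanSpace ℝ (Fin d))) :=
  Integrable.of_bound (hp.comp hq).aestronglyMeasurable C₀ (ae_of_all _ fun _ => h₀ _)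

theorem hasFDerivAt_gaussianAverage (A : Matrix (Fin d) (Fin d) ℝ) (s c : ℝ)
    {p : EuclideanSpace ℝ (Fin d) → ℝ} {C₀ C : ℝ} (hp : ContDiff ℝ 1 p) (h₀ : ∀ x, |p x| ≤ C₀)
    (h₁ : ∀ x, ‖fderiv ℝ p x‖ ≤ C) (x : EuclideanSpace ℝ (Fin d)) :
    HasFDerivAt (gaussianAverage A s c p)
      (∫ n, s • fderiv ℝ p (s • x + c • Matrix.toEuclideanCLM (n := Fin d) (𝕜 := ℝ) A n)
        ∂(stdGaussian (EuclideanSpace ℝ (Fin d)))) x := by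
  have hc := hp.continuous_fderiv one_ne_zero
  have hp0 := hp.continuous
  refine hasFDerivAt_integral_of_dominated_of_fderiv_le (s := Set.univ)
    (F' := fun x n => s • fderiv ℝ p (s • x + c • Matrix.toEuclideanCLM (n := Fin d) (𝕜 := ℝ) A n))
    (bound := fun _ => |s| * C) univ_mem ?_ ?_ ?_ ?_ (integrable_const _) ?_
  · exact Eventually.of_forall fun y => Continuous.aestronglyMeasurable (by fun_prop)
  · exact integrable_bounded_comp hp0 h₀ (by fun_prop)
  · exact Continuous.aestronglyMeasurable (by fun_prop)
  · refine ae_of_all _ fun n y _ => ?_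
    rw [norm_smul, Real.norm_eq_abs]
    exact mul_le_mul_of_nonneg_left (h₁ _) (abs_nonneg s)
  · refine ae_of_all _ fun n y _ => ?_
    have h1 := (hp.differentiable one_ne_zero
      (s • y + c • Matrix.toEuclideanCLM (n := Fin d) (𝕜 := ℝ) A n)).hasFDerivAt
    have h2 : HasFDerivAt (fun y => s • y + c • Matrix.toEuclideanCLM (n := Fin d) (𝕜 := ℝ) A n)
        (s • ContinuousLinearMap.id ℝ (EuclideanSpace ℝ (Fin d))) y :=
      ((hasFDerivAt_id y).const_smul s).add_const _
    refine (h1.comp y h2).congr_fderiv ?_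
    ext v
    simp

theorem fderiv_gaussianAverage (A : Matrix (Fin d) (Fin d) ℝ) (s c : ℝ)
    {p : EuclideanSpace ℝ (Fin d) → ℝ} {C₀ C : ℝ} (hp : ContDiff ℝ 1 p) (h₀ : ∀ x, |p x| ≤ C₀)
    (h₁ : ∀ x, ‖fderiv ℝ p x‖ ≤ C) (x : EuclideanSpace ℝ (Fin d)) :
    fderiv ℝ (gaussianAverage A s c p) x =
      ∫ n, s • fderiv ℝ p (s • x + c • Matrix.toEuclideanCLM (n := Fin d) (𝕜 := ℝ) A n)
        ∂(stdGaussian (EuclideanSpace ℝ (Fin d))) :=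
  (hasFDerivAt_gaussianAverage A s c hp h₀ h₁ x).fderiv

theorem norm_fderiv_gaussianAverage_le (A : Matrix (Fin d) (Fin d) ℝ) (s c : ℝ)
    {p : EuclideanSpace ℝ (Fin d) → ℝ} {C₀ C : ℝ} (hp : ContDiff ℝ 1 p) (h₀ : ∀ x, |p x| ≤ C₀)
    (h₁ : ∀ x, ‖fderiv ℝ p x‖ ≤ C) (x : EuclideanSpace ℝ (Fin d)) :
    ‖fderiv ℝ (gaussianAverage A s c p) x‖ ≤ |s| * C := by
  rw [fderiv_gaussianAverage A s c hp h₀ h₁]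
  refine (norm_integral_le_of_norm_le_const (C := |s| * C) (ae_of_all _ fun n => ?_)).trans
    (by simp)
  rw [norm_smul, Real.norm_eq_abs]
  exact mul_le_mul_of_nonneg_left (h₁ _) (abs_nonneg s)

theorem contDiff_gaussianAverage (A : Matrix (Fin d) (Fin d) ℝ) (s c : ℝ)
    {p : EuclideanSpace ℝ (Fin d) → ℝ} {C₀ C : ℝ} (hp : ContDiff ℝ 1 p) (h₀ : ∀ x, |p x| ≤ C₀)
    (h₁ : ∀ x, ‖fderiv ℝ p x‖ ≤ C) : ContDiff ℝ 1 (gaussianAverage A s c p) := by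
  have hc := hp.continuous_fderiv one_ne_zero
  refine contDiff_one_iff_fderiv.2
    ⟨fun x => (hasFDerivAt_gaussianAverage A s c hp h₀ h₁ x).differentiableAt, ?_⟩
  rw [funext (fderiv_gaussianAverage A s c hp h₀ h₁)]
  refine continuous_of_dominated (bound := fun _ => |s| * C)
    (fun x => Continuous.aestronglyMeasurable (by fun_prop)) (fun x => ae_of_all _ fun n => ?_)
    (integrable_const _) (ae_of_all _ fun n => by fun_prop)
  rw [norm_smul, Real.norm_eq_abs]
  exact mul_le_mul_of_nonneg_left (h₁ _) (abs_nonneg s)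

theorem fderiv_gaussianAverage_apply (A : Matrix (Fin d) (Fin d) ℝ) (s c : ℝ)
    {p : EuclideanSpace ℝ (Fin d) → ℝ} {C₀ C : ℝ} (hp : ContDiff ℝ 1 p) (h₀ : ∀ x, |p x| ≤ C₀)
    (h₁ : ∀ x, ‖fderiv ℝ p x‖ ≤ C) (x v : EuclideanSpace ℝ (Fin d)) :
    fderiv ℝ (gaussianAverage A s c p) x v =
      s * ∫ n, fderiv ℝ p (s • x + c • Matrix.toEuclideanCLM (n := Fin d) (𝕜 := ℝ) A n) v
        ∂(stdGaussian (EuclideanSpace ℝ (Fin d))) := by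
  have hc := hp.continuous_fderiv one_ne_zero
  have hi : Integrable (fun n => s • fderiv ℝ p
      (s • x + c • Matrix.toEuclideanCLM (n := Fin d) (𝕜 := ℝ) A n))
      (stdGaussian (EuclideanSpace ℝ (Fin d))) := by
    refine Integrable.of_bound (Continuous.aestronglyMeasurable (by fun_prop)) (|s| * C)
      (ae_of_all _ fun n => ?_)
    rw [norm_smul, Real.norm_eq_abs]
    exact mul_le_mul_of_nonneg_left (h₁ _) (abs_nonneg s)
  rw [fderiv_gaussianAverage A s c hp h₀ h₁, ContinuousLinearMap.integral_apply hi,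
    ← integral_const_mul]
  rfl

/-- Duality for the Hilbert-Schmidt norm. -/
theorem hsNorm_le_of_forall_sum_mul_le {K : Matrix (Fin d) (Fin d) ℝ} {c : ℝ}
    (h : ∀ B : Matrix (Fin d) (Fin d) ℝ, ∑ i, ∑ k, K i k * B i k ≤ c * hsNorm B) (hc : 0 ≤ c) :
    hsNorm K ≤ c := by
  have h1 := h K
  simp only [← sq] at h1
  rw [← hsNorm_sq, sq] at h1
  rcases (hsNorm_nonneg K).eq_or_lt with h0 | h0
  · rwa [← h0]
  · exact le_of_mul_le_mul_right h1 h0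

/-- `𝔼 |B N| ≤ ‖B‖_HS` for a standard Gaussian vector `N`. -/
theorem integral_norm_toEuclideanCLM_stdGaussian_le (B : Matrix (Fin d) (Fin d) ℝ) :
    Integrable (fun n => ‖Matrix.toEuclideanCLM (n := Fin d) (𝕜 := ℝ) B n‖)
      (stdGaussian (EuclideanSpace ℝ (Fin d))) ∧
    ∫ n, ‖Matrix.toEuclideanCLM (n := Fin d) (𝕜 := ℝ) B n‖
      ∂(stdGaussian (EuclideanSpace ℝ (Fin d))) ≤ hsNorm B := by
  set γ := stdGaussian (EuclideanSpace ℝ (Fin d))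
  have hm2 : MemLp (fun n => ‖Matrix.toEuclideanCLM (n := Fin d) (𝕜 := ℝ) B n‖) 2 γ :=
    ((Matrix.toEuclideanCLM (n := Fin d) (𝕜 := ℝ) B).comp_memLp' IsGaussian.memLp_two_id).norm
  refine ⟨hm2.integrable one_le_two, Real.le_sqrt_of_sq_le ?_⟩
  have hv := variance_nonneg (fun n => ‖Matrix.toEuclideanCLM (n := Fin d) (𝕜 := ℝ) B n‖) γ
  rw [variance_eq_sub hm2, sub_nonneg] at hv
  refine hv.trans (le_of_eq ?_)
  simp only [Pi.pow_apply, EuclideanSpace.real_norm_sq_eq]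
  have hrow : ∀ i, Integrable
      (fun n => Matrix.toEuclideanCLM (n := Fin d) (𝕜 := ℝ) B n i ^ 2) γ ∧
      ∫ n, Matrix.toEuclideanCLM (n := Fin d) (𝕜 := ℝ) B n i ^ 2 ∂γ = ∑ k, B i k ^ 2 := fun i => by
    set l : StrongDual ℝ (EuclideanSpace ℝ (Fin d)) :=
      innerSL ℝ (WithLp.toLp 2 fun k => B i k : EuclideanSpace ℝ (Fin d)) with hl
    have hlB : ∀ n, Matrix.toEuclideanCLM (n := Fin d) (𝕜 := ℝ) B n i = l n := fun n => by
      simp [hl, toEuclideanCLM_apply_coord, PiLp.inner_apply, mul_comm]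
    simp_rw [hlB]
    have hlm : MemLp l 2 γ := l.comp_memLp' IsGaussian.memLp_two_id
    refine ⟨hlm.integrable_sq, ?_⟩
    have h1 := variance_dual_stdGaussian l
    rw [variance_eq_sub hlm, integral_strongDual_stdGaussian] at h1
    simp only [Pi.pow_apply, ne_eq, OfNat.ofNat_ne_zero, not_false_eq_true, zero_pow,
      sub_zero] at h1
    rw [h1, hl, innerSL_apply_norm, EuclideanSpace.real_norm_sq_eq]
  rw [integral_finsetSum _ fun i _ => (hrow i).1]
  exact Finset.sum_congr rfl fun i _ => (hrow i).2

end Smoothing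

section SmoothedGradient

theorem integral_le_of_forall_abs_le {α : Type*} [MeasurableSpace α] {γ : Measure α}
    [IsProbabilityMeasure γ] {f : α → ℝ} {C : ℝ} (h : ∀ n, |f n| ≤ C) : ∫ n, f n ∂γ ≤ C := by
  have := norm_integral_le_of_norm_le_const (μ := γ) (f := f) (C := C) (ae_of_all _ h)
  rw [probReal_univ, mul_one] at this
  exact (le_abs_self _).trans this

theorem integral_sum_sum_mul {α : Type*} [MeasurableSpace α] {γ : Measure α} {d : ℕ}
    {f : Fin d → Fin d → α → ℝ} (hf : ∀ i k, Integrable (f i k) γ) (b : Fin d → Fin d → ℝ) :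
    ∫ n, ∑ i, ∑ k, f i k n * b i k ∂γ = ∑ i, ∑ k, (∫ n, f i k n ∂γ) * b i k := by
  rw [integral_finsetSum _ fun i _ => integrable_finsetSum _ fun k _ => (hf i k).mul_const _]
  refine Finset.sum_congr rfl fun i _ => ?_
  rw [integral_finsetSum _ fun k _ => (hf i k).mul_const _]
  exact Finset.sum_congr rfl fun k _ => integral_mul_const _ _

variable {d : ℕ} {g : EuclideanSpace ℝ (Fin d) → ℝ} {G H : ℝ}

theorem contDiff_partialDeriv (hg : ContDiff ℝ 2 g) (i : Fin d) :
    ContDiff ℝ 1 (partialDeriv g i) :=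
  (hg.fderiv_right (m := 1) (by norm_num)).clm_apply contDiff_const

theorem abs_partialDeriv_le (hG : ∀ x, ‖fderiv ℝ g x‖ ≤ G) (i : Fin d)
    (x : EuclideanSpace ℝ (Fin d)) : |partialDeriv g i x| ≤ G :=
  (abs_apply_single_le _ i).trans (hG x)

theorem fderiv_partialDeriv_apply (hg : ContDiff ℝ 2 g) (i k : Fin d)
    (x : EuclideanSpace ℝ (Fin d)) :
    fderiv ℝ (partialDeriv g i) x (EuclideanSpace.single k 1) = hessian g x k i := by
  have h1 : DifferentiableAt ℝ (fderiv ℝ g) x :=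
    (hg.fderiv_right (m := 1) (by norm_num)).differentiable one_ne_zero x
  have h2 := (h1.hasFDerivAt.clm_apply
    (hasFDerivAt_const (EuclideanSpace.single i (1 : ℝ)) x)).fderiv
  change fderiv ℝ (fun y => fderiv ℝ g y (EuclideanSpace.single i 1)) x _ = _
  rw [h2]
  simp [hessian]

theorem norm_fderiv_partialDeriv_le (hg : ContDiff ℝ 2 g) (hH : ∀ x, hsNorm (hessian g x) ≤ H)
    (i : Fin d) (x : EuclideanSpace ℝ (Fin d)) : ‖fderiv ℝ (partialDeriv g i) x‖ ≤ H := by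
  refine ContinuousLinearMap.opNorm_le_bound _ ((hsNorm_nonneg _).trans (hH x)) fun v => ?_
  refine le_trans ?_ (mul_le_mul_of_nonneg_right (hH x) (norm_nonneg v))
  rw [Real.norm_eq_abs]
  refine abs_le_of_sq_le_sq ?_ (mul_nonneg (hsNorm_nonneg _) (norm_nonneg v))
  rw [mul_pow, hsNorm_sq, EuclideanSpace.real_norm_sq_eq, clm_apply_eq_sum]
  simp only [fderiv_partialDeriv_apply hg]
  refine (Finset.sum_mul_sq_le_sq_mul_sq _ _ _).trans ?_
  rw [mul_comm]
  refine mul_le_mul_of_nonneg_right ?_ (Finset.sum_nonneg fun _ _ => sq_nonneg _)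
  exact Finset.sum_le_sum fun k _ => Finset.single_le_sum (f := fun i => hessian g x k i ^ 2)
    (fun _ _ => sq_nonneg _) (Finset.mem_univ i)

/-- The Gaussian average `x ↦ 𝔼 ∇g(s x + c A N)` of the gradient of `g`, as a family of
components. -/
noncomputable def smoothedGradient (A : Matrix (Fin d) (Fin d) ℝ) (s c : ℝ)
    (g : EuclideanSpace ℝ (Fin d) → ℝ) :
    Fin d → EuclideanSpace ℝ (Fin d) → ℝ :=
  fun i => gaussianAverage A s c (partialDeriv g i)

theorem norm_smoothedGradient_le (hg : ContDiff ℝ 2 g) (hG : ∀ x, ‖fderiv ℝ g x‖ ≤ G)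
    (A : Matrix (Fin d) (Fin d) ℝ) (s c : ℝ) (x : EuclideanSpace ℝ (Fin d)) :
    ‖(WithLp.toLp 2 fun i => smoothedGradient A s c g i x : EuclideanSpace ℝ (Fin d))‖ ≤ G := by
  set v : EuclideanSpace ℝ (Fin d) := WithLp.toLp 2 fun i => smoothedGradient A s c g i x with hv
  have hG0 : 0 ≤ G := (norm_nonneg _).trans (hG 0)
  have h1 : ‖v‖ ^ 2 ≤ G * ‖v‖ := by
    have h2 : ‖v‖ ^ 2 = ∫ n, fderiv ℝ g
        (s • x + c • Matrix.toEuclideanCLM (n := Fin d) (𝕜 := ℝ) A n) v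
          ∂(stdGaussian (EuclideanSpace ℝ (Fin d))) := by
      have hpt : ∀ n, fderiv ℝ g
          (s • x + c • Matrix.toEuclideanCLM (n := Fin d) (𝕜 := ℝ) A n) v = ∑ i, v i *
          partialDeriv g i (s • x + c • Matrix.toEuclideanCLM (n := Fin d) (𝕜 := ℝ) A n) :=
        fun n => clm_apply_eq_sum _ _
      simp_rw [hpt]
      rw [integral_finsetSum _ fun i _ => (integrable_bounded_comp
          (contDiff_partialDeriv hg i).continuous (abs_partialDeriv_le hG i)
          (q := fun n => s • x + c • Matrix.toEuclideanCLM (n := Fin d) (𝕜 := ℝ) A n)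
          (by fun_prop)).const_mul (v i), EuclideanSpace.real_norm_sq_eq]
      refine Finset.sum_congr rfl fun i _ => ?_
      rw [integral_const_mul, sq]
      rfl
    rw [h2]
    refine integral_le_of_forall_abs_le fun n => ?_
    exact (ContinuousLinearMap.le_opNorm _ _).trans
      (mul_le_mul_of_nonneg_right (hG _) (norm_nonneg v))
  rcases (norm_nonneg v).eq_or_lt with h0 | h0
  · rwa [← h0]
  · rw [sq] at h1
    exact le_of_mul_le_mul_right h1 h0

theorem jacobian_smoothedGradient (hg : ContDiff ℝ 2 g) (hG : ∀ x, ‖fderiv ℝ g x‖ ≤ G)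
    (hH : ∀ x, hsNorm (hessian g x) ≤ H) (A : Matrix (Fin d) (Fin d) ℝ) (s c : ℝ)
    (x : EuclideanSpace ℝ (Fin d)) (i k : Fin d) :
    jacobian (smoothedGradient A s c g) x i k =
      s * ∫ n, hessian g (s • x + c • Matrix.toEuclideanCLM (n := Fin d) (𝕜 := ℝ) A n) k i
        ∂(stdGaussian (EuclideanSpace ℝ (Fin d))) := by
  simp only [← fderiv_partialDeriv_apply hg]
  exact fderiv_gaussianAverage_apply A s c (contDiff_partialDeriv hg i) (abs_partialDeriv_le hG i)
    (norm_fderiv_partialDeriv_le hg hH i) x _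

theorem integrable_hessian_comp (hg : ContDiff ℝ 2 g) (hH : ∀ x, hsNorm (hessian g x) ≤ H)
    {q : EuclideanSpace ℝ (Fin d) → EuclideanSpace ℝ (Fin d)} (hq : Continuous q) (i k : Fin d) :
    Integrable (fun n => hessian g (q n) k i) (stdGaussian (EuclideanSpace ℝ (Fin d))) := by
  simp only [← fderiv_partialDeriv_apply hg]
  exact integrable_bounded_comp
    (((contDiff_partialDeriv hg i).continuous_fderiv one_ne_zero).clm_apply continuous_const)
    (fun x => (abs_apply_single_le _ k).trans (norm_fderiv_partialDeriv_le hg hH i x)) hq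

theorem hsNorm_jacobian_smoothedGradient_le (hg : ContDiff ℝ 2 g) (hG : ∀ x, ‖fderiv ℝ g x‖ ≤ G)
    (hH : ∀ x, hsNorm (hessian g x) ≤ H) (A : Matrix (Fin d) (Fin d) ℝ) {s : ℝ} (hs : 0 ≤ s)
    (c : ℝ) (x : EuclideanSpace ℝ (Fin d)) :
    hsNorm (jacobian (smoothedGradient A s c g) x) ≤ s * H := by
  have hH0 : 0 ≤ H := (hsNorm_nonneg _).trans (hH 0)
  refine hsNorm_le_of_forall_sum_mul_le (fun B => ?_) (mul_nonneg hs hH0)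
  have hi := fun i k => integrable_hessian_comp hg hH (q := fun n =>
    s • x + c • Matrix.toEuclideanCLM (n := Fin d) (𝕜 := ℝ) A n) (by fun_prop) i k
  have h1 : ∑ i, ∑ k, jacobian (smoothedGradient A s c g) x i k * B i k =
      s * ∫ n, ∑ i, ∑ k, (hessian g (s • x +
        c • Matrix.toEuclideanCLM (n := Fin d) (𝕜 := ℝ) A n)).transpose i k * B i k
        ∂(stdGaussian (EuclideanSpace ℝ (Fin d))) := by
    simp only [Matrix.transpose_apply]
    refine Eq.trans ?_ (congrArg (s * ·) (integral_sum_sum_mul hi fun i k => B i k).symm)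
    simp only [jacobian_smoothedGradient hg hG hH, Finset.mul_sum, mul_assoc]
  rw [h1, mul_assoc]
  refine mul_le_mul_of_nonneg_left ?_ hs
  refine integral_le_of_forall_abs_le fun n => ?_
  refine (abs_sum_mul_le_hsNorm_mul_hsNorm _ _).trans ?_
  rw [hsNorm_transpose]
  exact mul_le_mul_of_nonneg_right (hH _) (hsNorm_nonneg _)

/-- The matrix `𝔼 ∂_i g(s x + c A N) N_l`. -/
noncomputable def gradientNoiseMatrix (A : Matrix (Fin d) (Fin d) ℝ) (s c : ℝ)
    (g : EuclideanSpace ℝ (Fin d) → ℝ) (x : EuclideanSpace ℝ (Fin d)) : Matrix (Fin d) (Fin d) ℝ :=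
  Matrix.of fun i l => ∫ n, n l * partialDeriv g i
    (s • x + c • Matrix.toEuclideanCLM (n := Fin d) (𝕜 := ℝ) A n)
      ∂(stdGaussian (EuclideanSpace ℝ (Fin d)))

/-- Gaussian integration by parts trades a second derivative of `g` for a factor `N`. -/
theorem smul_gradientNoiseMatrix (hg : ContDiff ℝ 2 g) (hG : ∀ x, ‖fderiv ℝ g x‖ ≤ G)
    (hH : ∀ x, hsNorm (hessian g x) ≤ H) (A : Matrix (Fin d) (Fin d) ℝ) (s c : ℝ)
    (x : EuclideanSpace ℝ (Fin d)) :
    s • gradientNoiseMatrix A s c g x = c • (jacobian (smoothedGradient A s c g) x * A) := by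
  ext i l
  have hp := contDiff_partialDeriv hg i
  have hder : ∀ n, HasFDerivAt (fun n => partialDeriv g i
      (s • x + c • Matrix.toEuclideanCLM (n := Fin d) (𝕜 := ℝ) A n))
      ((fderiv ℝ (partialDeriv g i)
        (s • x + c • Matrix.toEuclideanCLM (n := Fin d) (𝕜 := ℝ) A n)).comp
          (c • Matrix.toEuclideanCLM (n := Fin d) (𝕜 := ℝ) A)) n := fun n => by
    refine (hp.differentiable one_ne_zero _).hasFDerivAt.comp n ?_
    exact ((Matrix.toEuclideanCLM (n := Fin d) (𝕜 := ℝ) A).hasFDerivAt.const_smul c).const_add _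
  have hibp := integral_coord_mul_stdGaussian (f := fun n => partialDeriv g i
    (s • x + c • Matrix.toEuclideanCLM (n := Fin d) (𝕜 := ℝ) A n)) (C := G)
    (C' := H * ‖c • Matrix.toEuclideanCLM (n := Fin d) (𝕜 := ℝ) A‖)
    (hp.comp (by fun_prop)) (fun n => abs_partialDeriv_le hG i _) (fun n => by
      rw [(hder n).fderiv]
      exact (ContinuousLinearMap.opNorm_comp_le _ _).trans
        (mul_le_mul_of_nonneg_right (norm_fderiv_partialDeriv_le hg hH i _) (norm_nonneg _))) l
  have hi := fun k => integrable_hessian_comp hg hH (q := fun n =>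
    s • x + c • Matrix.toEuclideanCLM (n := Fin d) (𝕜 := ℝ) A n) (by fun_prop) i k
  have hpt : ∀ n, fderiv ℝ (fun n => partialDeriv g i
      (s • x + c • Matrix.toEuclideanCLM (n := Fin d) (𝕜 := ℝ) A n)) n
      (EuclideanSpace.single l 1) = c * ∑ k, A k l * hessian g
        (s • x + c • Matrix.toEuclideanCLM (n := Fin d) (𝕜 := ℝ) A n) k i := fun n => by
    rw [(hder n).fderiv, ContinuousLinearMap.comp_apply, smul_apply,
      map_smul, smul_eq_mul, clm_apply_eq_sum]
    simp only [fderiv_partialDeriv_apply hg, toEuclideanCLM_apply_coord]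
    simp
  simp only [Matrix.smul_apply, smul_eq_mul, gradientNoiseMatrix, Matrix.of_apply,
    Matrix.mul_apply, jacobian_smoothedGradient hg hG hH]
  rw [hibp]
  simp_rw [hpt]
  rw [integral_const_mul, integral_finsetSum _ fun k _ => (hi k).const_mul _]
  simp only [integral_const_mul, Finset.mul_sum]
  exact Finset.sum_congr rfl fun k _ => by ring

theorem integrable_coord_mul_partialDeriv (hg : ContDiff ℝ 2 g) (hG : ∀ x, ‖fderiv ℝ g x‖ ≤ G)
    {q : EuclideanSpace ℝ (Fin d) → EuclideanSpace ℝ (Fin d)} (hq : Continuous q) (i l : Fin d) :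
    Integrable (fun n => n l * partialDeriv g i (q n))
      (stdGaussian (EuclideanSpace ℝ (Fin d))) := by
  have hp := (contDiff_partialDeriv hg i).continuous
  refine Integrable.mul_bdd (c := G) ?_ (hp.comp hq).aestronglyMeasurable
    (ae_of_all _ fun n => abs_partialDeriv_le hG i _)
  exact (EuclideanSpace.proj (𝕜 := ℝ) l).integrable_comp IsGaussian.integrable_id

/-- Pairing the gradient with the noise `B N` gives the Hilbert-Schmidt product with `B`. -/
theorem integral_fderiv_apply_noise (hg : ContDiff ℝ 2 g) (hG : ∀ x, ‖fderiv ℝ g x‖ ≤ G)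
    (A B : Matrix (Fin d) (Fin d) ℝ) (s c : ℝ) (x : EuclideanSpace ℝ (Fin d)) :
    ∫ n, fderiv ℝ g (s • x + c • Matrix.toEuclideanCLM (n := Fin d) (𝕜 := ℝ) A n)
      (Matrix.toEuclideanCLM (n := Fin d) (𝕜 := ℝ) B n)
        ∂(stdGaussian (EuclideanSpace ℝ (Fin d))) =
      ∑ i, ∑ l, gradientNoiseMatrix A s c g x i l * B i l := by
  have hi := fun i l => integrable_coord_mul_partialDeriv hg hG (q := fun n =>
    s • x + c • Matrix.toEuclideanCLM (n := Fin d) (𝕜 := ℝ) A n) (by fun_prop) i l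
  have hpt : ∀ n, fderiv ℝ g (s • x + c • Matrix.toEuclideanCLM (n := Fin d) (𝕜 := ℝ) A n)
      (Matrix.toEuclideanCLM (n := Fin d) (𝕜 := ℝ) B n) =
      ∑ i, ∑ l, (n l * partialDeriv g i
        (s • x + c • Matrix.toEuclideanCLM (n := Fin d) (𝕜 := ℝ) A n)) * B i l := fun n => by
    rw [clm_apply_eq_sum]
    refine Finset.sum_congr rfl fun i _ => ?_
    rw [toEuclideanCLM_apply_coord, Finset.sum_mul]
    refine Finset.sum_congr rfl fun l _ => ?_
    simp only [partialDeriv]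
    ring
  simp_rw [hpt]
  exact integral_sum_sum_mul hi fun i l => B i l

/-- By duality with `𝔼 |B N| ≤ ‖B‖_HS`. -/
theorem hsNorm_gradientNoiseMatrix_le (hg : ContDiff ℝ 2 g) (hG : ∀ x, ‖fderiv ℝ g x‖ ≤ G)
    (A : Matrix (Fin d) (Fin d) ℝ) (s c : ℝ) (x : EuclideanSpace ℝ (Fin d)) :
    hsNorm (gradientNoiseMatrix A s c g x) ≤ G := by
  have hG0 : 0 ≤ G := (norm_nonneg _).trans (hG 0)
  refine hsNorm_le_of_forall_sum_mul_le (fun B => ?_) hG0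
  obtain ⟨hB, hBle⟩ := integral_norm_toEuclideanCLM_stdGaussian_le B
  rw [← integral_fderiv_apply_noise hg hG]
  refine (Real.le_norm_self _).trans ((norm_integral_le_of_norm_le (hB.const_mul G)
    (ae_of_all _ fun n => ?_)).trans ?_)
  · exact (ContinuousLinearMap.le_opNorm _ _).trans
      (mul_le_mul_of_nonneg_right (hG _) (norm_nonneg _))
  · rw [integral_const_mul]
    exact mul_le_mul_of_nonneg_left hBle hG0

/-- For an invertible `A`, the Jacobian of the smoothed gradient is controlled by the gradient
alone. -/
theorem mul_hsNorm_jacobian_smoothedGradient_le (hg : ContDiff ℝ 2 g)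
    (hG : ∀ x, ‖fderiv ℝ g x‖ ≤ G) (hH : ∀ x, hsNorm (hessian g x) ≤ H)
    {A : Matrix (Fin d) (Fin d) ℝ} (hA : IsUnit A) (hAs : A.transpose = A) {s c : ℝ} (hs : 0 ≤ s)
    (hc : 0 ≤ c) (x : EuclideanSpace ℝ (Fin d)) :
    c * hsNorm (jacobian (smoothedGradient A s c g) x) ≤ s * (opNorm A⁻¹ * G) := by
  have hhom : ∀ {r : ℝ} (_ : 0 ≤ r) (M : Matrix (Fin d) (Fin d) ℝ),
      hsNorm (r • M) = r * hsNorm M := fun {r} hr M => by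
    simp only [hsNorm, Matrix.smul_apply, smul_eq_mul, mul_pow, ← Finset.mul_sum]
    rw [Real.sqrt_mul (sq_nonneg r), Real.sqrt_sq hr]
  have hdet : IsUnit A.det := (Matrix.isUnit_iff_isUnit_det A).1 hA
  have h1 : c • jacobian (smoothedGradient A s c g) x =
      s • (gradientNoiseMatrix A s c g x * (A⁻¹).transpose) := by
    rw [Matrix.transpose_nonsing_inv, hAs, ← Matrix.smul_mul, smul_gradientNoiseMatrix hg hG hH,
      Matrix.smul_mul, Matrix.mul_assoc, Matrix.mul_nonsing_inv _ hdet, Matrix.mul_one]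
  rw [← hhom hc, h1, hhom hs]
  refine mul_le_mul_of_nonneg_left ((hsNorm_mul_le' _ _).trans ?_) hs
  exact mul_le_mul_of_nonneg_left (hsNorm_gradientNoiseMatrix_le hg hG A s c x) (opNorm_nonneg _)

end SmoothedGradient

/-! ### Interpolation between the law of `F` and the Gaussian law -/

section Interpolation

variable {S : Type*} [MeasurableSpace S] {μ : Measure S} [IsProbabilityMeasure μ] {d : ℕ}
  {F : S → EuclideanSpace ℝ (Fin d)} {g : EuclideanSpace ℝ (Fin d) → ℝ} {G H : ℝ}

theorem abs_sub_le_of_norm_fderiv_le (hg : Differentiable ℝ g) (hG : ∀ x, ‖fderiv ℝ g x‖ ≤ G)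
    (x y : EuclideanSpace ℝ (Fin d)) : |g y - g x| ≤ G * ‖y - x‖ :=
  convex_univ.norm_image_sub_le_of_norm_fderiv_le (fun z _ => hg z) (fun z _ => hG z)
    (Set.mem_univ x) (Set.mem_univ y)

theorem integrable_comp_of_norm_fderiv_le {α : Type*} [MeasurableSpace α] {ν : Measure α}
    [IsFiniteMeasure ν] (hg : Differentiable ℝ g) (hG : ∀ x, ‖fderiv ℝ g x‖ ≤ G)
    {W : α → EuclideanSpace ℝ (Fin d)} (hW : Integrable W ν) :
    Integrable (fun a => g (W a)) ν := by
  refine ((hW.norm.const_mul G).add (integrable_const |g 0|)).mono'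
    (hg.continuous.comp_aestronglyMeasurable hW.1) (ae_of_all _ fun a => ?_)
  have h1 := abs_sub_le_of_norm_fderiv_le hg hG 0 (W a)
  rw [sub_zero] at h1
  calc ‖g (W a)‖ = |(g (W a) - g 0) + g 0| := by rw [sub_add_cancel, Real.norm_eq_abs]
    _ ≤ |g (W a) - g 0| + |g 0| := abs_add_le _ _
    _ ≤ G * ‖W a‖ + |g 0| := by linarith

/-- The interpolation `θ ↦ 𝔼 g(sin θ F + cos θ A N)` between the Gaussian law (`θ = 0`) and the law
of `F` (`θ = π / 2`), with `N` a standard Gaussian vector independent of `F`. -/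
noncomputable def interpolation (μ : Measure S) (F : S → EuclideanSpace ℝ (Fin d))
    (A : Matrix (Fin d) (Fin d) ℝ) (g : EuclideanSpace ℝ (Fin d) → ℝ) (θ : ℝ) : ℝ :=
  ∫ p : S × EuclideanSpace ℝ (Fin d), g (Real.sin θ • F p.1 +
    Real.cos θ • Matrix.toEuclideanCLM (n := Fin d) (𝕜 := ℝ) A p.2)
      ∂(μ.prod (stdGaussian (EuclideanSpace ℝ (Fin d))))

/-- Differentiation along the rotation of a pair `(W, Y)` of integrable random vectors. -/
theorem hasDerivAt_integral_comp_rotation {α : Type*} [MeasurableSpace α] {ν : Measure α}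
    [IsFiniteMeasure ν] {W Y : α → EuclideanSpace ℝ (Fin d)} (hW : Integrable W ν)
    (hY : Integrable Y ν) (hg : ContDiff ℝ 1 g) (hG : ∀ x, ‖fderiv ℝ g x‖ ≤ G) (θ : ℝ) :
    Integrable (fun a => fderiv ℝ g (Real.sin θ • W a + Real.cos θ • Y a)
      (Real.cos θ • W a - Real.sin θ • Y a)) ν ∧
    HasDerivAt (fun θ => ∫ a, g (Real.sin θ • W a + Real.cos θ • Y a) ∂ν)
      (∫ a, fderiv ℝ g (Real.sin θ • W a + Real.cos θ • Y a)
        (Real.cos θ • W a - Real.sin θ • Y a) ∂ν) θ := by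
  have hG0 : 0 ≤ G := (norm_nonneg _).trans (hG 0)
  have hd : Differentiable ℝ g := hg.differentiable one_ne_zero
  have hu : ∀ s c : ℝ, Integrable (fun a => s • W a + c • Y a) ν := fun s c =>
    (hW.smul s).add (hY.smul c)
  have hu' : ∀ s c : ℝ, Integrable (fun a => s • W a - c • Y a) ν := fun s c =>
    (hW.smul s).sub (hY.smul c)
  have hm : AEStronglyMeasurable (fun a => fderiv ℝ g (Real.sin θ • W a + Real.cos θ • Y a)
      (Real.cos θ • W a - Real.sin θ • Y a)) ν := by
    have h1 := (hg.continuous_fderiv one_ne_zero).comp_aestronglyMeasurable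
      (hu (Real.sin θ) (Real.cos θ)).1
    have h2 : AEStronglyMeasurable (fun a => Real.cos θ • W a - Real.sin θ • Y a) ν :=
      (hu' (Real.cos θ) (Real.sin θ)).1
    have h3 : Continuous fun q : (EuclideanSpace ℝ (Fin d) →L[ℝ] ℝ) × EuclideanSpace ℝ (Fin d) =>
        q.1 q.2 := by fun_prop
    exact h3.comp_aestronglyMeasurable (h1.prodMk h2)
  have hbi : Integrable (fun a => G * (‖W a‖ + ‖Y a‖)) ν := (hW.norm.add hY.norm).const_mul G
  have hb : ∀ (a : α) (ϑ : ℝ), ‖fderiv ℝ g (Real.sin ϑ • W a + Real.cos ϑ • Y a)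
      (Real.cos ϑ • W a - Real.sin ϑ • Y a)‖ ≤ G * (‖W a‖ + ‖Y a‖) := fun a ϑ => by
    refine (ContinuousLinearMap.le_opNorm _ _).trans
      (mul_le_mul (hG _) ((norm_sub_le _ _).trans (add_le_add ?_ ?_)) (norm_nonneg _) hG0)
    · rw [norm_smul]
      exact mul_le_of_le_one_left (norm_nonneg _) (Real.abs_cos_le_one ϑ)
    · rw [norm_smul]
      exact mul_le_of_le_one_left (norm_nonneg _) (Real.abs_sin_le_one ϑ)
  have hder : ∀ (a : α) (ϑ : ℝ), HasDerivAt
      (fun ϑ => g (Real.sin ϑ • W a + Real.cos ϑ • Y a))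
      (fderiv ℝ g (Real.sin ϑ • W a + Real.cos ϑ • Y a)
        (Real.cos ϑ • W a - Real.sin ϑ • Y a)) ϑ := fun a ϑ => by
    refine (hd _).hasFDerivAt.comp_hasDerivAt ϑ ?_
    refine (((Real.hasDerivAt_sin ϑ).smul_const (W a)).add
      ((Real.hasDerivAt_cos ϑ).smul_const (Y a))).congr_deriv ?_
    rw [neg_smul, ← sub_eq_add_neg]
  exact hasDerivAt_integral_of_dominated_loc_of_deriv_le (s := Set.univ) univ_mem
    (Eventually.of_forall fun ϑ => hg.continuous.comp_aestronglyMeasurable (hu _ _).1)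
    (integrable_comp_of_norm_fderiv_le hd hG (hu _ _)) hm
    (ae_of_all _ fun a ϑ _ => hb a ϑ) hbi (ae_of_all _ fun a ϑ _ => hder a ϑ)

/-- The derivative of the interpolation is the expectation of the Stein operator of
`N(0, A Aᵀ)`, applied to the smoothed gradient of `g`. -/
theorem hasDerivAt_interpolation_steinOperator (hF : Integrable F μ) (hg : ContDiff ℝ 2 g)
    (hG : ∀ x, ‖fderiv ℝ g x‖ ≤ G) (hH : ∀ x, hsNorm (hessian g x) ≤ H)
    {A Sig : Matrix (Fin d) (Fin d) ℝ} (hA : A * A.transpose = Sig) (θ : ℝ) :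
    HasDerivAt (interpolation μ F A g) (Real.cos θ *
      ∫ x, (∑ i, smoothedGradient A (Real.sin θ) (Real.cos θ) g i (F x) * F x i -
        ∑ i, ∑ k, Sig i k *
          jacobian (smoothedGradient A (Real.sin θ) (Real.cos θ) g) (F x) i k) ∂μ) θ := by
  have hAi : Integrable (fun n => Matrix.toEuclideanCLM (n := Fin d) (𝕜 := ℝ) A n)
      (stdGaussian (EuclideanSpace ℝ (Fin d))) :=
    (Matrix.toEuclideanCLM (n := Fin d) (𝕜 := ℝ) A).integrable_comp IsGaussian.integrable_id
  obtain ⟨hi, hd⟩ := hasDerivAt_integral_comp_rotation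
    (hF.comp_fst (stdGaussian (EuclideanSpace ℝ (Fin d)))) (hAi.comp_snd μ)
    (hg.of_le (by norm_num)) hG θ
  refine hd.congr_deriv (Eq.symm ?_)
  rw [integral_prod _ hi, ← integral_const_mul]
  refine integral_congr_ae (ae_of_all _ fun x => ?_)
  simp only [map_sub, map_smul, smul_eq_mul]
  set s := Real.sin θ
  set c := Real.cos θ
  set γ := stdGaussian (EuclideanSpace ℝ (Fin d))
  have hq : Continuous fun n => s • F x +
    c • Matrix.toEuclideanCLM (n := Fin d) (𝕜 := ℝ) A n := by fun_prop
  have hc1 := hg.continuous_fderiv two_ne_zero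
  have i1 : Integrable (fun n => fderiv ℝ g (s • F x +
      c • Matrix.toEuclideanCLM (n := Fin d) (𝕜 := ℝ) A n) (F x)) γ :=
    Integrable.of_bound (Continuous.aestronglyMeasurable (by fun_prop)) (G * ‖F x‖)
      (ae_of_all _ fun n => (ContinuousLinearMap.le_opNorm _ _).trans
        (mul_le_mul_of_nonneg_right (hG _) (norm_nonneg _)))
  have i2 : Integrable (fun n => fderiv ℝ g (s • F x +
      c • Matrix.toEuclideanCLM (n := Fin d) (𝕜 := ℝ) A n)
      (Matrix.toEuclideanCLM (n := Fin d) (𝕜 := ℝ) A n)) γ :=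
    ((integral_norm_toEuclideanCLM_stdGaussian_le A).1.const_mul G).mono'
      (Continuous.aestronglyMeasurable (by fun_prop))
      (ae_of_all _ fun n => (ContinuousLinearMap.le_opNorm _ _).trans
        (mul_le_mul_of_nonneg_right (hG _) (norm_nonneg _)))
  rw [integral_sub (i1.const_mul c) (i2.const_mul s), integral_const_mul, integral_const_mul,
    integral_fderiv_apply_noise hg hG, mul_sub]
  congr 1
  · congr 1
    have hpt : ∀ n, fderiv ℝ g (s • F x + c • Matrix.toEuclideanCLM (n := Fin d) (𝕜 := ℝ) A n)
        (F x) = ∑ i, F x i * partialDeriv g i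
          (s • F x + c • Matrix.toEuclideanCLM (n := Fin d) (𝕜 := ℝ) A n) :=
      fun n => clm_apply_eq_sum _ _
    simp_rw [hpt]
    rw [integral_finsetSum _ fun i _ => (integrable_bounded_comp
      (contDiff_partialDeriv hg i).continuous (abs_partialDeriv_le hG i) hq).const_mul (F x i)]
    refine Finset.sum_congr rfl fun i _ => ?_
    rw [integral_const_mul, mul_comm]
    rfl
  · have hN := smul_gradientNoiseMatrix hg hG hH A s c (F x)
    have hN' : ∀ i l, s * gradientNoiseMatrix A s c g (F x) i l =
        c * ∑ k, jacobian (smoothedGradient A s c g) (F x) i k * A k l := fun i l => by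
      have := congrFun (congrFun hN i) l
      simpa [Matrix.mul_apply] using this
    have hS : ∀ i k, Sig i k = ∑ l, A k l * A i l := fun i k => by
      rw [← hA, Matrix.mul_apply]
      exact Finset.sum_congr rfl fun l _ => by rw [Matrix.transpose_apply, mul_comm]
    simp only [hS, Finset.mul_sum, Finset.sum_mul]
    simp only [← mul_assoc, hN']
    simp only [Finset.mul_sum, Finset.sum_mul]
    refine Finset.sum_congr rfl fun i _ => ?_
    rw [Finset.sum_comm]
    exact Finset.sum_congr rfl fun l _ => Finset.sum_congr rfl fun k _ => by ring

/-- Integration of a bound `B'` on the derivative of the interpolation. -/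
theorem abs_integral_sub_integral_stdGaussian_le (hF : Integrable F μ) (hg : ContDiff ℝ 2 g)
    (hG : ∀ x, ‖fderiv ℝ g x‖ ≤ G) (hH : ∀ x, hsNorm (hessian g x) ≤ H)
    {A Sig : Matrix (Fin d) (Fin d) ℝ} (hA : A * A.transpose = Sig) {B B' : ℝ → ℝ}
    (hB : ∀ θ, HasDerivAt B (B' θ) θ)
    (hbound : ∀ θ ∈ Set.Ico 0 (Real.pi / 2), Real.cos θ *
      |∫ x, (∑ i, smoothedGradient A (Real.sin θ) (Real.cos θ) g i (F x) * F x i -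
        ∑ i, ∑ k, Sig i k *
          jacobian (smoothedGradient A (Real.sin θ) (Real.cos θ) g) (F x) i k) ∂μ| ≤ B' θ) :
    |∫ x, g (F x) ∂μ - ∫ n, g (Matrix.toEuclideanCLM (n := Fin d) (𝕜 := ℝ) A n)
      ∂(stdGaussian (EuclideanSpace ℝ (Fin d)))| ≤ B (Real.pi / 2) - B 0 := by
  have hder := hasDerivAt_interpolation_steinOperator hF hg hG hH hA
  have hend : interpolation μ F A g (Real.pi / 2) = ∫ x, g (F x) ∂μ := by
    simp [interpolation, integral_fun_fst (μ := μ) (f := fun x => g (F x))]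
  have hstart : interpolation μ F A g 0 =
      ∫ n, g (Matrix.toEuclideanCLM (n := Fin d) (𝕜 := ℝ) A n)
        ∂(stdGaussian (EuclideanSpace ℝ (Fin d))) := by
    simp [interpolation, integral_fun_snd (μ := μ)
      (f := fun n => g (Matrix.toEuclideanCLM (n := Fin d) (𝕜 := ℝ) A n))]
  have hpi : (0 : ℝ) ≤ Real.pi / 2 := by positivity
  have h := image_norm_le_of_norm_deriv_right_le_deriv_boundary
    (f := fun θ => interpolation μ F A g θ - interpolation μ F A g 0) (a := 0) (b := Real.pi / 2)
    (B := fun θ => B θ - B 0)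
    (fun θ _ => ((hder θ).sub_const _).continuousAt.continuousWithinAt)
    (fun θ _ => ((hder θ).sub_const _).hasDerivWithinAt) (by simp)
    (fun θ => (hB θ).sub_const _) (fun θ hθ => ?_) (Set.right_mem_Icc.2 hpi)
  · rwa [hend, hstart, Real.norm_eq_abs] at h
  · rw [norm_mul, Real.norm_eq_abs, Real.norm_eq_abs, abs_of_nonneg]
    · exact hbound θ hθ
    · exact Real.cos_nonneg_of_mem_Icc ⟨by linarith [hθ.1], hθ.2.le⟩

end Interpolation

/-! ### Smooth approximation of Lipschitz functions -/

section Mollifier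

open scoped Convolution

variable {d : ℕ}

theorem norm_convolution_sub_le {E' E'' : Type*} [NormedAddCommGroup E'] [NormedSpace ℝ E']
    [NormedAddCommGroup E''] [NormedSpace ℝ E''] (L : E' →L[ℝ] ℝ →L[ℝ] E'')
    {u : EuclideanSpace ℝ (Fin d) → E'} {f : EuclideanSpace ℝ (Fin d) → ℝ}
    (hu : Continuous u) (hcu : HasCompactSupport u) (hf : LipschitzWith 1 f)
    (x y : EuclideanSpace ℝ (Fin d)) :
    ‖(u ⋆[L, volume] f) x - (u ⋆[L, volume] f) y‖ ≤ (‖L‖ * ∫ t, ‖u t‖) * ‖x - y‖ := by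
  have hex := hcu.convolutionExists_left L hu hf.continuous.locallyIntegrable (μ := volume)
  rw [convolution_def, convolution_def, ← integral_sub (hex x) (hex y)]
  have hi : Integrable u := hu.integrable_of_hasCompactSupport hcu
  refine (norm_integral_le_of_norm_le (g := fun t => ‖L‖ * ‖u t‖ * ‖x - y‖)
    ((hi.norm.const_mul _).mul_const _) (ae_of_all _ fun t => ?_)).trans (le_of_eq ?_)
  · rw [← map_sub]
    refine (L.le_opNorm₂ _ _).trans ?_
    gcongr
    have := hf.dist_le_mul (x - t) (y - t)
    rwa [NNReal.coe_one, one_mul, dist_sub_right, dist_eq_norm, dist_eq_norm] at this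
  · rw [integral_mul_const, integral_const_mul]

theorem exists_norm_convolution_sub_le {E' E'' : Type*} [NormedAddCommGroup E'] [NormedSpace ℝ E']
    [NormedAddCommGroup E''] [NormedSpace ℝ E''] (L : E' →L[ℝ] ℝ →L[ℝ] E'')
    {u : EuclideanSpace ℝ (Fin d) → E'} {f : EuclideanSpace ℝ (Fin d) → ℝ}
    (hu : Continuous u) (hcu : HasCompactSupport u) (hf : LipschitzWith 1 f) :
    ∃ K : ℝ, 0 ≤ K ∧
      ∀ x y, ‖(u ⋆[L, volume] f) x - (u ⋆[L, volume] f) y‖ ≤ K * ‖x - y‖ :=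
  ⟨‖L‖ * ∫ t, ‖u t‖, mul_nonneg L.opNorm_nonneg (integral_nonneg fun _ => norm_nonneg _),
    norm_convolution_sub_le L hu hcu hf⟩

/-- A `1`-Lipschitz function is a uniform limit of smooth functions with gradient bounded by `1` and
bounded Hessian: convolve with a bump function. -/
theorem exists_contDiff_approx {f : EuclideanSpace ℝ (Fin d) → ℝ} (hf : LipschitzWith 1 f) {ε : ℝ}
    (hε : 0 < ε) : ∃ (g : EuclideanSpace ℝ (Fin d) → ℝ) (H : ℝ), ContDiff ℝ 2 g ∧
      (∀ x, ‖fderiv ℝ g x‖ ≤ 1) ∧ (∀ x, hsNorm (hessian g x) ≤ H) ∧ ∀ x, |g x - f x| ≤ ε := by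
  let φ : ContDiffBump (0 : EuclideanSpace ℝ (Fin d)) := ⟨ε / 2, ε, by positivity, by linarith⟩
  set u := φ.normed (volume : Measure (EuclideanSpace ℝ (Fin d))) with hu
  set L := ContinuousLinearMap.lsmul ℝ ℝ (E := ℝ) with hL
  have hus : ContDiff ℝ 2 u := φ.contDiff_normed
  have hcu : HasCompactSupport u := φ.hasCompactSupport_normed
  have hloc : LocallyIntegrable f (volume : Measure (EuclideanSpace ℝ (Fin d))) :=
    hf.continuous.locallyIntegrable
  set g := u ⋆[L, volume] f with hg
  have hgs : ContDiff ℝ 2 g := hcu.contDiff_convolution_left L hus hloc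
  have hfd : fderiv ℝ g = fderiv ℝ u ⋆[L.precompL (EuclideanSpace ℝ (Fin d)), volume] f :=
    funext fun x => (hcu.hasFDerivAt_convolution_left L (hus.of_le (by norm_num)) hloc x).fderiv
  have hg1 : ∀ x y, ‖g x - g y‖ ≤ 1 * ‖x - y‖ := fun x y => by
    refine (norm_convolution_sub_le L hus.continuous hcu hf x y).trans ?_
    refine mul_le_mul_of_nonneg_right ?_ (norm_nonneg _)
    have h1 : ∫ t, ‖u t‖ = 1 := by
      simp_rw [hu, Real.norm_of_nonneg (φ.nonneg_normed _)]
      exact φ.integral_normed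
    rw [h1, mul_one]
    exact ContinuousLinearMap.opNorm_lsmul_le
  obtain ⟨K, hK0, hg2⟩ : ∃ K : ℝ, 0 ≤ K ∧
      ∀ x y, ‖fderiv ℝ g x - fderiv ℝ g y‖ ≤ K * ‖x - y‖ := by
    rw [hfd]
    exact exists_norm_convolution_sub_le _ (hus.continuous_fderiv two_ne_zero) (hcu.fderiv ℝ) hf
  refine ⟨g, Real.sqrt (∑ _j : Fin d, ∑ _k : Fin d, K ^ 2), hgs, fun x => ?_, fun x => ?_,
    fun x => ?_⟩
  · exact norm_fderiv_le_of_lip' ℝ zero_le_one (Eventually.of_forall fun y => hg1 y x)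
  · refine Real.sqrt_le_sqrt (Finset.sum_le_sum fun j _ => Finset.sum_le_sum fun k _ => ?_)
    have h1 : ‖fderiv ℝ (fderiv ℝ g) x‖ ≤ K :=
      norm_fderiv_le_of_lip' ℝ hK0 (Eventually.of_forall fun y => hg2 y x)
    rw [← sq_abs]
    refine pow_le_pow_left₀ (abs_nonneg _) ?_ 2
    refine (abs_apply_single_le _ k).trans ((ContinuousLinearMap.le_opNorm _ _).trans ?_)
    rw [PiLp.norm_single, norm_one, mul_one]
    exact h1
  · rw [← Real.dist_eq]
    refine φ.dist_normed_convolution_le hf.continuous.aestronglyMeasurable fun y hy => ?_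
    have := hf.dist_le_mul y x
    rw [NNReal.coe_one, one_mul] at this
    exact this.trans (Metric.mem_ball.1 hy).le

end Mollifier

/-! ### Normal approximation for reversible processes -/

section Bounds

variable {S : Type*} [MeasurableSpace S] {μ : Measure S} [IsProbabilityMeasure μ] {d : ℕ}
  {F L e₁ : S → EuclideanSpace ℝ (Fin d)} {Γ e₂ : S → Matrix (Fin d) (Fin d) ℝ}
  {Λ Sig A : Matrix (Fin d) (Fin d) ℝ} {g : EuclideanSpace ℝ (Fin d) → ℝ} {G H : ℝ}

theorem abs_integral_steinOperator_smoothedGradient_le (hid : SatisfiesSteinIdentity μ F L Γ)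
    (hΛ : IsUnit Λ) (hFi : Integrable F μ) (he₁ : Integrable e₁ μ)
    (he₂ : ∀ j k, Integrable (fun x => e₂ x j k) μ)
    (hL : ∀ x, L x = -(Matrix.toEuclideanCLM (n := Fin d) (𝕜 := ℝ) Λ (F x)) + e₁ x)
    (hΓ : ∀ x, Γ x = Λ * Sig + e₂ x)
    (hg : ContDiff ℝ 2 g) (hG : ∀ x, ‖fderiv ℝ g x‖ ≤ G) (hH : ∀ x, hsNorm (hessian g x) ≤ H)
    (s c : ℝ) {B₁ : ℝ} (hB₁ : ∀ x, hsNorm (jacobian (smoothedGradient A s c g) x) ≤ B₁) :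
    |∫ x, (∑ i, smoothedGradient A s c g i (F x) * F x i -
      ∑ i, ∑ k, Sig i k * jacobian (smoothedGradient A s c g) (F x) i k) ∂μ| ≤
      opNorm Λ⁻¹ * (G * ∫ x, ‖e₁ x‖ ∂μ + B₁ * ∫ x, hsNorm (e₂ x) ∂μ) :=
  abs_integral_steinOperator_le hid hΛ hFi he₁ he₂ hL hΓ
    (fun i => contDiff_gaussianAverage A s c (contDiff_partialDeriv hg i)
      (abs_partialDeriv_le hG i) (norm_fderiv_partialDeriv_le hg hH i))
    (fun i x => norm_fderiv_gaussianAverage_le A s c (contDiff_partialDeriv hg i)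
      (abs_partialDeriv_le hG i) (norm_fderiv_partialDeriv_le hg hH i) x)
    (norm_smoothedGradient_le hg hG A s c) hB₁

/-- With `‖Dφ‖ ≤ sin θ · H`, the derivative of the interpolation is bounded by that of
`G I₁ sin θ + H I₂ sin² θ / 2`, up to the factor `‖Λ⁻¹‖`. -/
theorem abs_integral_sub_integral_le_hessian (hid : SatisfiesSteinIdentity μ F L Γ)
    (hΛ : IsUnit Λ) (hFi : Integrable F μ) (he₁ : Integrable e₁ μ)
    (he₂ : ∀ j k, Integrable (fun x => e₂ x j k) μ)
    (hL : ∀ x, L x = -(Matrix.toEuclideanCLM (n := Fin d) (𝕜 := ℝ) Λ (F x)) + e₁ x)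
    (hΓ : ∀ x, Γ x = Λ * Sig + e₂ x) (hA : A * A.transpose = Sig)
    (hg : ContDiff ℝ 2 g) (hG : ∀ x, ‖fderiv ℝ g x‖ ≤ G) (hH : ∀ x, hsNorm (hessian g x) ≤ H) :
    |∫ x, g (F x) ∂μ - ∫ n, g (Matrix.toEuclideanCLM (n := Fin d) (𝕜 := ℝ) A n)
      ∂(stdGaussian (EuclideanSpace ℝ (Fin d)))| ≤
      opNorm Λ⁻¹ * (G * ∫ x, ‖e₁ x‖ ∂μ + 1 / 2 * H * ∫ x, hsNorm (e₂ x) ∂μ) := by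
  set I₁ := ∫ x, ‖e₁ x‖ ∂μ
  set I₂ := ∫ x, hsNorm (e₂ x) ∂μ
  have h := abs_integral_sub_integral_stdGaussian_le hFi hg hG hH hA
    (B := fun θ => opNorm Λ⁻¹ * (G * I₁ * Real.sin θ + 1 / 2 * H * I₂ * Real.sin θ ^ 2))
    (B' := fun θ => Real.cos θ * (opNorm Λ⁻¹ * (G * I₁ + Real.sin θ * H * I₂)))
    (fun θ => ?_) (fun θ hθ => ?_)
  · refine h.trans (le_of_eq ?_)
    simp
  · have hs := Real.hasDerivAt_sin θ
    refine (((hs.const_mul (G * I₁)).add ((hs.pow 2).const_mul (1 / 2 * H * I₂))).const_mul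
      (opNorm Λ⁻¹)).congr_deriv ?_
    push_cast
    ring
  · have hc := Real.cos_nonneg_of_mem_Icc ⟨by linarith [hθ.1, Real.pi_pos], hθ.2.le⟩
    have hs := Real.sin_nonneg_of_mem_Icc ⟨hθ.1, by linarith [hθ.2, Real.pi_pos]⟩
    exact mul_le_mul_of_nonneg_left (abs_integral_steinOperator_smoothedGradient_le hid hΛ hFi he₁
      he₂ hL hΓ hg hG hH _ _ (hsNorm_jacobian_smoothedGradient_le hg hG hH A hs _)) hc

/-- With `cos θ ‖Dφ‖ ≤ sin θ ‖A⁻¹‖ G`, the Hessian bound `H` no longer enters the estimate; the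
integral of `sin θ` over `[0, π / 2]` is `1`. -/
theorem abs_integral_sub_integral_le_gradient (hid : SatisfiesSteinIdentity μ F L Γ)
    (hΛ : IsUnit Λ) (hFi : Integrable F μ) (he₁ : Integrable e₁ μ)
    (he₂ : ∀ j k, Integrable (fun x => e₂ x j k) μ)
    (hL : ∀ x, L x = -(Matrix.toEuclideanCLM (n := Fin d) (𝕜 := ℝ) Λ (F x)) + e₁ x)
    (hΓ : ∀ x, Γ x = Λ * Sig + e₂ x) (hA : A * A.transpose = Sig) (hAs : A.transpose = A)
    (hAu : IsUnit A)
    (hg : ContDiff ℝ 2 g) (hG : ∀ x, ‖fderiv ℝ g x‖ ≤ G) (hH : ∀ x, hsNorm (hessian g x) ≤ H) :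
    |∫ x, g (F x) ∂μ - ∫ n, g (Matrix.toEuclideanCLM (n := Fin d) (𝕜 := ℝ) A n)
      ∂(stdGaussian (EuclideanSpace ℝ (Fin d)))| ≤
      G * (opNorm Λ⁻¹ * (∫ x, ‖e₁ x‖ ∂μ + opNorm A⁻¹ * ∫ x, hsNorm (e₂ x) ∂μ)) := by
  set I₁ := ∫ x, ‖e₁ x‖ ∂μ
  set I₂ := ∫ x, hsNorm (e₂ x) ∂μ
  have h := abs_integral_sub_integral_stdGaussian_le hFi hg hG hH hA
    (B := fun θ => opNorm Λ⁻¹ * (G * I₁ * Real.sin θ + opNorm A⁻¹ * G * I₂ * -Real.cos θ))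
    (B' := fun θ => opNorm Λ⁻¹ *
      (G * I₁ * Real.cos θ + opNorm A⁻¹ * G * I₂ * -(-Real.sin θ)))
    (fun θ => ?_) (fun θ hθ => ?_)
  · refine h.trans (le_of_eq ?_)
    simp only [Real.sin_pi_div_two, Real.cos_pi_div_two, Real.sin_zero, Real.cos_zero]
    ring
  · exact (((Real.hasDerivAt_sin θ).const_mul (G * I₁)).add
      ((Real.hasDerivAt_cos θ).neg.const_mul (opNorm A⁻¹ * G * I₂))).const_mul (opNorm Λ⁻¹)
  · have hc := Real.cos_pos_of_mem_Ioo ⟨by linarith [hθ.1, Real.pi_pos], hθ.2⟩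
    have hs := Real.sin_nonneg_of_mem_Icc ⟨hθ.1, by linarith [hθ.2, Real.pi_pos]⟩
    refine (mul_le_mul_of_nonneg_left (abs_integral_steinOperator_smoothedGradient_le hid hΛ hFi
      he₁ he₂ hL hΓ hg hG hH _ _
      (B₁ := Real.sin θ * (opNorm A⁻¹ * G) / Real.cos θ) fun x => ?_) hc.le).trans (le_of_eq ?_)
    · rw [le_div_iff₀ hc, mul_comm]
      exact mul_hsNorm_jacobian_smoothedGradient_le hg hG hH hAu hAs hs hc.le x
    · field_simp
      ring

end Bounds

/-! ### From extended to real integrals, and degenerate cases -/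

section Conversion

variable {S : Type*} [MeasurableSpace S] {μ : Measure S} {κ : ℝ≥0 → Kernel S S} {d : ℕ}
  {F : S → EuclideanSpace ℝ (Fin d)}

theorem norm_fderiv_le_supGrad {g : EuclideanSpace ℝ (Fin d) → ℝ} (hg : supGrad g ≠ ∞)
    (x : EuclideanSpace ℝ (Fin d)) : ‖fderiv ℝ g x‖ ≤ (supGrad g).toReal := by
  have h1 : ENNReal.ofReal ‖gradient g x‖ ≤ supGrad g :=
    le_iSup (fun x => ENNReal.ofReal ‖gradient g x‖) x
  have h2 : ‖gradient g x‖ = ‖fderiv ℝ g x‖ := by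
    rw [gradient, LinearIsometryEquiv.norm_map]
  rw [← h2]
  exact (ENNReal.ofReal_le_iff_le_toReal hg).1 h1

theorem hsNorm_hessian_le_supHess {g : EuclideanSpace ℝ (Fin d) → ℝ} (hg : supHess g ≠ ∞)
    (x : EuclideanSpace ℝ (Fin d)) : hsNorm (hessian g x) ≤ (supHess g).toReal :=
  (ENNReal.ofReal_le_iff_le_toReal hg).1
    (le_iSup (fun x => ENNReal.ofReal (hsNorm (hessian g x))) x)

theorem opNorm_ne_zero [NeZero d] {A : Matrix (Fin d) (Fin d) ℝ} (hA : IsUnit A) :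
    opNorm A ≠ 0 := by
  intro h
  rw [opNorm, norm_eq_zero] at h
  exact hA.ne_zero ((Matrix.toEuclideanCLM (n := Fin d) (𝕜 := ℝ)).injective
    (h.trans (map_zero _).symm))

theorem measurable_hsNorm {α : Type*} [MeasurableSpace α] {E : α → Matrix (Fin d) (Fin d) ℝ}
    (h : ∀ j k, Measurable fun a => E a j k) : Measurable fun a => hsNorm (E a) :=
  (Finset.measurable_fun_sum _ fun j _ => Finset.measurable_fun_sum _ fun k _ =>
    (h j k).pow_const 2).sqrt

theorem integrable_hsNorm_and_entry {E : S → Matrix (Fin d) (Fin d) ℝ}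
    (h : ∀ j k, Measurable fun x => E x j k) (hfin : ∫⁻ x, ENNReal.ofReal (hsNorm (E x)) ∂μ ≠ ∞) :
    Integrable (fun x => hsNorm (E x)) μ ∧ ∀ j k, Integrable (fun x => E x j k) μ := by
  have h1 : Integrable (fun x => hsNorm (E x)) μ :=
    (lintegral_ofReal_ne_top_iff_integrable (measurable_hsNorm h).aestronglyMeasurable
      (ae_of_all _ fun x => hsNorm_nonneg _)).1 hfin
  exact ⟨h1, fun j k => h1.mono' (h j k).aestronglyMeasurable
    (ae_of_all _ fun x => abs_entry_le_hsNorm _ j k)⟩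

theorem generatorVec_apply (x : S) (j : Fin d) :
    generatorVec κ F x j = generator κ (fun y => F y j) x := rfl

theorem measurable_generatorVec (hκ : ∀ t, IsMarkovKernel (κ t))
    (hF : ∀ j, InDomain κ (fun x => F x j)) : Measurable (generatorVec κ F) :=
  (WithLp.measurable_toLp 2 (Fin d → ℝ)).comp
    (measurable_pi_lambda _ fun j => (hF j).measurable_generator hκ)

theorem integrable_generatorVec [IsProbabilityMeasure μ] (hκ : ∀ t, IsMarkovKernel (κ t))
    (hrev : ∀ t, (κ t).IsReversible μ)
    (hF : ∀ j, InDomain κ (fun x => F x j)) (hFint : Integrable F μ) :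
    Integrable (generatorVec κ F) μ := by
  have hi : ∀ j, Integrable (generator κ fun y => F y j) μ := fun j =>
    integrable_generator (hF j) hκ hrev ((EuclideanSpace.proj (𝕜 := ℝ) j).integrable_comp hFint)
  refine (integrable_finsetSum Finset.univ fun j _ => (hi j).abs).mono'
    (measurable_generatorVec hκ hF).aestronglyMeasurable (ae_of_all _ fun x => ?_)
  rw [EuclideanSpace.norm_eq]
  refine Real.sqrt_le_iff.2 ⟨by positivity, ?_⟩
  simp only [Real.norm_eq_abs, generatorVec_apply]
  exact Finset.sum_sq_le_sq_sum_of_nonneg fun _ _ => abs_nonneg _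

/-- The Lindeberg condition, in terms of the joint law `μ ⊗ₘ κ t` and with real integrals. -/
theorem tendsto_lindeberg_compProd {Ω : Type*} [MeasurableSpace Ω] {P : Measure Ω}
    [IsProbabilityMeasure P] {X : ℝ≥0 → Ω → S} (hX : IsStationaryReversibleMarkov κ μ P X)
    (hF : Measurable F) {ρ : ℝ}
    (h : Tendsto (fun t : ℝ≥0 => (t : ℝ≥0∞)⁻¹ *
      ∫⁻ ω, {ω | ρ < ‖F (X t ω) - F (X 0 ω)‖}.indicator
        (fun ω => ENNReal.ofReal (‖F (X t ω) - F (X 0 ω)‖ ^ 2)) ω ∂P) (𝓝[>] 0) (𝓝 0)) :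
    Tendsto (fun t : ℝ≥0 => (t : ℝ)⁻¹ *
      ∫ p : S × S, (if ρ < ‖F p.2 - F p.1‖ then ‖F p.2 - F p.1‖ ^ 2 else 0) ∂(μ ⊗ₘ κ t))
      (𝓝[>] 0) (𝓝 0) := by
  have h1 := (ENNReal.tendsto_toReal ENNReal.zero_ne_top).comp h
  rw [ENNReal.toReal_zero] at h1
  refine h1.congr fun t => ?_
  have hm : Measurable fun p : S × S =>
      (if ρ < ‖F p.2 - F p.1‖ then ‖F p.2 - F p.1‖ ^ 2 else 0 : ℝ) :=
    Measurable.ite (measurableSet_lt measurable_const (by fun_prop)) (by fun_prop)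
      measurable_const
  have hm0 := hX.measurable 0
  have hmt := hX.measurable t
  rw [integral_eq_lintegral_of_nonneg_ae (ae_of_all _ fun p => by
    simp only [Pi.zero_apply]; split_ifs <;> positivity) hm.aestronglyMeasurable,
    ← hX.map_prodMk t, lintegral_map hm.ennreal_ofReal (by fun_prop)]
  simp only [Function.comp_apply, ENNReal.toReal_mul, ENNReal.toReal_inv, ENNReal.coe_toReal]
  congr 3 with ω
  simp only [Set.indicator_apply, Set.mem_ofPred_eq]
  split_ifs <;> simp

open scoped MatrixOrder in
theorem sqrt_mul_transpose_sqrt {Sig : Matrix (Fin d) (Fin d) ℝ} (hSig : Sig.PosSemidef) :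
    (CFC.sqrt Sig).transpose = CFC.sqrt Sig ∧ CFC.sqrt Sig * (CFC.sqrt Sig).transpose = Sig := by
  have h : (CFC.sqrt Sig).transpose = CFC.sqrt Sig := by
    have := (CFC.sqrt_nonneg Sig).isSelfAdjoint.star_eq
    rwa [Matrix.star_eq_conjTranspose, Matrix.conjTranspose_eq_transpose_of_trivial] at this
  exact ⟨h, by rw [h, CFC.sqrt_mul_sqrt_self _ hSig.nonneg]⟩

open scoped MatrixOrder in
theorem integral_multivariateGaussian_zero {Sig : Matrix (Fin d) (Fin d) ℝ}
    {f : EuclideanSpace ℝ (Fin d) → ℝ} (hf : Continuous f) :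
    ∫ z, f z ∂(multivariateGaussian 0 Sig) =
      ∫ n, f (Matrix.toEuclideanCLM (n := Fin d) (𝕜 := ℝ) (CFC.sqrt Sig) n)
        ∂(stdGaussian (EuclideanSpace ℝ (Fin d))) := by
  rw [multivariateGaussian, integral_map (by fun_prop) hf.aestronglyMeasurable]
  simp

/-- With vanishing Hessian `g` is affine, and its expectation depends on the mean only. -/
theorem integral_comp_eq_of_hessian_eq_zero {α : Type*} [MeasurableSpace α] {ν : Measure α}
    [IsProbabilityMeasure ν] {g : EuclideanSpace ℝ (Fin d) → ℝ} (hg : ContDiff ℝ 2 g)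
    (hH : ∀ x, hsNorm (hessian g x) ≤ 0) {W : α → EuclideanSpace ℝ (Fin d)}
    (hW : Integrable W ν) (hW0 : ∫ a, W a ∂ν = 0) : ∫ a, g (W a) ∂ν = g 0 := by
  have hd : Differentiable ℝ g := hg.differentiable two_ne_zero
  have hp : ∀ i x, partialDeriv g i x = partialDeriv g i 0 := fun i x =>
    is_const_of_fderiv_eq_zero (𝕜 := ℝ) ((contDiff_partialDeriv hg i).differentiable one_ne_zero)
      (fun y => norm_le_zero_iff.1 (norm_fderiv_partialDeriv_le hg hH i y)) x 0
  have hf : ∀ x, fderiv ℝ g x = fderiv ℝ g 0 := fun x => by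
    ext v
    rw [clm_apply_eq_sum, clm_apply_eq_sum]
    exact Finset.sum_congr rfl fun i _ => congrArg _ (hp i x)
  have haff : ∀ x, g x = g 0 + fderiv ℝ g 0 x := fun x => by
    have h0 := is_const_of_fderiv_eq_zero (𝕜 := ℝ) (f := fun y => g y - fderiv ℝ g 0 y)
      (hd.sub (fderiv ℝ g 0).differentiable) (fun y => by
        rw [fderiv_fun_sub (hd y) (fderiv ℝ g 0).differentiableAt, hf y,
          ContinuousLinearMap.fderiv, sub_self]) x 0
    simp only [map_zero, sub_zero] at h0
    linarith
  simp_rw [fun a => haff (W a)]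
  rw [integral_add (integrable_const _) ((fderiv ℝ g 0).integrable_comp hW),
    (fderiv ℝ g 0).integral_comp_comm hW, hW0]
  simp

open scoped MatrixOrder in
theorem isUnit_sqrt {Sig : Matrix (Fin d) (Fin d) ℝ} (hSig : Sig.PosSemidef) (h : IsUnit Sig) :
    IsUnit (CFC.sqrt Sig) := by
  rw [← (sqrt_mul_transpose_sqrt hSig).2] at h
  exact isUnit_of_mul_isUnit_left h

theorem abs_integral_comp_sub_le {α : Type*} [MeasurableSpace α] {ν : Measure α}
    [IsProbabilityMeasure ν] {f g : EuclideanSpace ℝ (Fin d) → ℝ} {G ε : ℝ} (hf : Continuous f)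
    (hg : Differentiable ℝ g) (hG : ∀ x, ‖fderiv ℝ g x‖ ≤ G) (hfg : ∀ x, |g x - f x| ≤ ε)
    {W : α → EuclideanSpace ℝ (Fin d)} (hW : Integrable W ν) :
    |∫ a, g (W a) ∂ν - ∫ a, f (W a) ∂ν| ≤ ε := by
  have h1 := integrable_comp_of_norm_fderiv_le hg hG hW
  have h2 : Integrable (fun a => g (W a) - f (W a)) ν :=
    Integrable.of_bound (h1.1.sub (hf.comp_aestronglyMeasurable hW.1)) ε
      (ae_of_all _ fun a => hfg _)
  have h3 : Integrable (fun a => f (W a)) ν :=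
    (h1.sub h2).congr (ae_of_all _ fun a => by simp)
  rw [← integral_sub h1 h3, ← Real.norm_eq_abs]
  refine (norm_integral_le_of_norm_le_const (ae_of_all _ fun a => hfg (W a))).trans ?_
  simp

end Conversion

theorem theoremT
    {S Ω : Type*} [MeasurableSpace S] [MeasurableSpace Ω]
    (P : Measure Ω) [IsProbabilityMeasure P] (μ : Measure S)
    (κ : ℝ≥0 → Kernel S S) (X : ℝ≥0 → Ω → S)
    (hX : IsStationaryReversibleMarkov κ μ P X)
    (d : ℕ) (F : S → EuclideanSpace ℝ (Fin d))
    -- `F` is in the domain of `L`, and so are the products for which `Γ(F, F)` is defined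
    (hF : ∀ j, InDomain κ (fun x => F x j))
    (hFF : ∀ j k, InDomain κ (fun x => F x j * F x k))
    -- `𝔼 F(X₀) = 0`
    (hFint : Integrable (fun ω => F (X 0 ω)) P)
    (hFmean : ∫ ω, F (X 0 ω) ∂P = 0)
    (Λ : Matrix (Fin d) (Fin d) ℝ) (hΛ : IsUnit Λ)
    (Sig : Matrix (Fin d) (Fin d) ℝ) (hSig : Sig.PosSemidef)
    -- `X₀`-measurable random vector `E₁` and random matrix `E₂`
    (E₁ : Ω → EuclideanSpace ℝ (Fin d))
    (hE₁ : Measurable[MeasurableSpace.comap (X 0) inferInstance] E₁)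
    (E₂ : Ω → Matrix (Fin d) (Fin d) ℝ)
    (hE₂ : ∀ j k, Measurable[MeasurableSpace.comap (X 0) inferInstance] (fun ω => E₂ ω j k))
    -- `L F(X₀) = -Λ F(X₀) + E₁`
    (hL : ∀ᵐ ω ∂P, generatorVec κ F (X 0 ω) =
      -(Matrix.toEuclideanCLM (n := Fin d) (𝕜 := ℝ) Λ (F (X 0 ω))) + E₁ ω)
    -- `Γ(F, F)(X₀) = Λ Σ + E₂`
    (hΓ : ∀ᵐ ω ∂P, carreDuChampMat κ F F (X 0 ω) = Λ * Sig + E₂ ω)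
    -- Lindeberg-type condition
    (hLindeberg : ∀ ρ : ℝ, 0 < ρ →
      Tendsto
        (fun t : ℝ≥0 => (t : ℝ≥0∞)⁻¹ *
          ∫⁻ ω, {ω | ρ < ‖F (X t ω) - F (X 0 ω)‖}.indicator
            (fun ω => ENNReal.ofReal (‖F (X t ω) - F (X 0 ω)‖ ^ 2)) ω ∂P)
        (𝓝[>] 0) (𝓝 0)) :
    (∀ g : EuclideanSpace ℝ (Fin d) → ℝ, ContDiff ℝ 2 g → supGrad g ≠ ∞ → supHess g ≠ ∞ →
      Integrable (fun ω => g (F (X 0 ω))) P ∧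
      Integrable g (multivariateGaussian 0 Sig) ∧
      ENNReal.ofReal |(∫ ω, g (F (X 0 ω)) ∂P) - ∫ z, g z ∂(multivariateGaussian 0 Sig)| ≤
        ENNReal.ofReal (opNorm Λ⁻¹) *
          (supGrad g * (∫⁻ ω, ENNReal.ofReal ‖E₁ ω‖ ∂P) +
            1 / 2 * supHess g * ∫⁻ ω, ENNReal.ofReal (hsNorm (E₂ ω)) ∂P)) ∧
    (IsUnit Sig →
      wasserstein (P.map (fun ω => F (X 0 ω))) (multivariateGaussian 0 Sig) ≤
        ENNReal.ofReal (opNorm Λ⁻¹) *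
          ((∫⁻ ω, ENNReal.ofReal ‖E₁ ω‖ ∂P) +
            ENNReal.ofReal (opNorm (invSqrt Sig)) *
              ∫⁻ ω, ENNReal.ofReal (hsNorm (E₂ ω)) ∂P)) := by
  have hκ := hX.isMarkovKernel
  have hm0 : Measurable (X 0) := hX.measurable 0
  have hμP : P.map (X 0) = μ := hX.stationary 0
  have hμ : IsProbabilityMeasure μ := hμP ▸ Measure.isProbabilityMeasure_map hm0.aemeasurable
  have hFm : Measurable F := measurable_of_inDomain_coord hF
  have hrev := hX.reversible
  have hFi : Integrable F μ := by
    rw [← hμP]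
    exact (integrable_map_measure hFm.aestronglyMeasurable hm0.aemeasurable).2 hFint
  have hFmean' : ∫ x, F x ∂μ = 0 := by
    rw [← hμP, integral_map hm0.aemeasurable hFm.aestronglyMeasurable, hFmean]
  -- the error terms as functions on the state space
  set e₁ : S → EuclideanSpace ℝ (Fin d) := fun x =>
    generatorVec κ F x + Matrix.toEuclideanCLM (n := Fin d) (𝕜 := ℝ) Λ (F x) with he₁
  set e₂ : S → Matrix (Fin d) (Fin d) ℝ := fun x => carreDuChampMat κ F F x - Λ * Sig with he₂
  have he₁i : Integrable e₁ μ := (integrable_generatorVec hκ hrev hF hFi).add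
    ((Matrix.toEuclideanCLM (n := Fin d) (𝕜 := ℝ) Λ).integrable_comp hFi)
  have he₁m : Measurable e₁ := (measurable_generatorVec hκ hF).add
    ((Matrix.toEuclideanCLM (n := Fin d) (𝕜 := ℝ) Λ).continuous.measurable.comp hFm)
  have he₂m : ∀ j k, Measurable fun x => e₂ x j k := fun j k =>
    (measurable_carreDuChamp (hF j) (hF k) (hFF j k) hκ).sub_const _
  have hL' : ∀ x, generatorVec κ F x =
      -(Matrix.toEuclideanCLM (n := Fin d) (𝕜 := ℝ) Λ (F x)) + e₁ x := fun x => by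
    simp [he₁]
  have hΓ' : ∀ x, carreDuChampMat κ F F x = Λ * Sig + e₂ x := fun x => by
    simp [he₂]
  have hJ₁ : ∫⁻ ω, ENNReal.ofReal ‖E₁ ω‖ ∂P = ENNReal.ofReal (∫ x, ‖e₁ x‖ ∂μ) := by
    rw [ofReal_integral_eq_lintegral_ofReal he₁i.norm (ae_of_all _ fun x => norm_nonneg _), ← hμP,
      lintegral_map he₁m.norm.ennreal_ofReal hm0]
    refine lintegral_congr_ae (hL.mono fun ω hω => ?_)
    simp only [he₁, hω]
    congr 2
    abel
  have hJ₂ : ∫⁻ ω, ENNReal.ofReal (hsNorm (E₂ ω)) ∂P =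
      ∫⁻ x, ENNReal.ofReal (hsNorm (e₂ x)) ∂μ := by
    rw [← hμP, lintegral_map (measurable_hsNorm he₂m).ennreal_ofReal hm0]
    refine lintegral_congr_ae (hΓ.mono fun ω hω => ?_)
    simp only [he₂, hω, add_sub_cancel_left]
  have hid : (∀ j k, Integrable (fun x => e₂ x j k) μ) →
      SatisfiesSteinIdentity μ F (generatorVec κ F) (carreDuChampMat κ F F) := by
    intro h ψ C₀ C hψ hC₀ hC j
    refine integral_generator_add_carreDuChamp_eq_zero hκ hrev hF hFF hFi (fun j k => ?_)
      (fun ρ hρ => tendsto_lindeberg_compProd hX hFm (hLindeberg ρ hρ)) hψ hC₀ hC j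
    refine ((integrable_const ((Λ * Sig) j k)).add (h j k)).congr (ae_of_all _ fun x => ?_)
    exact (congrFun (congrFun (hΓ' x) j) k).symm
  obtain ⟨hAs, hA⟩ := sqrt_mul_transpose_sqrt hSig
  -- in dimension `0` all operator norms vanish, but so does the error term
  have hNeZero : ∫⁻ x, ENNReal.ofReal (hsNorm (e₂ x)) ∂μ = ∞ → NeZero d := fun h => by
    refine ⟨fun hd => ?_⟩
    subst hd
    simp [hsNorm] at h
  have hMI₁ : 0 ≤ ∫ x, ‖e₁ x‖ ∂μ := integral_nonneg fun _ => norm_nonneg _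
  have hMI₂ : 0 ≤ ∫ x, hsNorm (e₂ x) ∂μ := integral_nonneg fun _ => hsNorm_nonneg _
  have hΛinv : IsUnit Λ⁻¹ := (Matrix.isUnit_nonsing_inv_iff).2 hΛ
  have hΛ0 : 0 ≤ opNorm Λ⁻¹ := opNorm_nonneg _
  have hlaw : ∀ f : EuclideanSpace ℝ (Fin d) → ℝ, Continuous f →
      ∫ ω, f (F (X 0 ω)) ∂P = ∫ x, f (F x) ∂μ := fun f hf => by
    have hfF : Measurable fun x => f (F x) := hf.measurable.comp hFm
    rw [← hμP, integral_map hm0.aemeasurable hfF.aestronglyMeasurable]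
  rw [hJ₁, hJ₂]
  constructor
  · intro g hg hgG hgH
    have hgd : Differentiable ℝ g := hg.differentiable two_ne_zero
    have hG := norm_fderiv_le_supGrad hgG
    have hH := hsNorm_hessian_le_supHess hgH
    refine ⟨integrable_comp_of_norm_fderiv_le hgd hG hFint,
      integrable_comp_of_norm_fderiv_le hgd hG IsGaussian.integrable_id, ?_⟩
    rw [hlaw g hg.continuous]
    -- an infinite error term makes the bound infinite, unless its factor `supHess g` vanishes
    by_cases hfin : ∫⁻ x, ENNReal.ofReal (hsNorm (e₂ x)) ∂μ = ∞
    · have := hNeZero hfin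
      by_cases hH0 : supHess g = 0
      · have hHz : ∀ x, hsNorm (hessian g x) ≤ 0 := fun x => by simpa [hH0] using hH x
        have h2 := integral_comp_eq_of_hessian_eq_zero hg hHz
          (IsGaussian.integrable_id (μ := multivariateGaussian 0 Sig))
          integral_id_multivariateGaussian'
        simp only [id] at h2
        rw [integral_comp_eq_of_hessian_eq_zero hg hHz hFi hFmean', h2]
        simp
      · rw [hfin, ENNReal.mul_top (by simp [hH0]), add_top, ENNReal.mul_top]
        · exact le_top
        · simpa using lt_of_le_of_ne hΛ0 (opNorm_ne_zero hΛinv).symm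
    · obtain ⟨hi, he₂i⟩ := integrable_hsNorm_and_entry he₂m hfin
      have hmain := abs_integral_sub_integral_le_hessian (hid he₂i) hΛ hFi he₁i he₂i hL' hΓ' hA
        hg hG hH
      rw [integral_multivariateGaussian_zero hg.continuous]
      refine (ENNReal.ofReal_le_ofReal hmain).trans (le_of_eq ?_)
      rw [← ofReal_integral_eq_lintegral_ofReal hi (ae_of_all _ fun x => hsNorm_nonneg _),
        ENNReal.ofReal_mul hΛ0, ENNReal.ofReal_add (by positivity) (by positivity),
        ENNReal.ofReal_mul ENNReal.toReal_nonneg, ENNReal.ofReal_toReal hgG,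
        ENNReal.ofReal_mul (by positivity), ENNReal.ofReal_mul (by positivity),
        ENNReal.ofReal_toReal hgH]
      congr 4
      rw [ENNReal.ofReal_div_of_pos two_pos]
      simp
  · intro hSu
    have hAu := isUnit_sqrt hSig hSu
    have hAinv : IsUnit (invSqrt Sig) := (Matrix.isUnit_nonsing_inv_iff).2 hAu
    have hA0 : 0 ≤ opNorm (invSqrt Sig) := opNorm_nonneg _
    by_cases hfin : ∫⁻ x, ENNReal.ofReal (hsNorm (e₂ x)) ∂μ = ∞
    · have := hNeZero hfin
      rw [hfin, ENNReal.mul_top, add_top, ENNReal.mul_top]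
      · exact le_top
      · simpa using lt_of_le_of_ne hΛ0 (opNorm_ne_zero hΛinv).symm
      · simpa using lt_of_le_of_ne hA0 (opNorm_ne_zero hAinv).symm
    obtain ⟨hi, he₂i⟩ := integrable_hsNorm_and_entry he₂m hfin
    rw [← ofReal_integral_eq_lintegral_ofReal hi (ae_of_all _ fun x => hsNorm_nonneg _),
      ← ENNReal.ofReal_mul hA0, ← ENNReal.ofReal_add hMI₁ (mul_nonneg hA0 hMI₂),
      ← ENNReal.ofReal_mul hΛ0]
    refine iSup₂_le fun f hf => ENNReal.ofReal_le_ofReal (le_of_forall_pos_le_add fun ε hε => ?_)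
    have hFX : Measurable fun ω => F (X 0 ω) := hFm.comp hm0
    rw [integral_map hFX.aemeasurable hf.continuous.aestronglyMeasurable,
      hlaw f hf.continuous]
    obtain ⟨g, H, hg, hG, hH, hgf⟩ := exists_contDiff_approx hf (half_pos hε)
    have hmain := abs_integral_sub_integral_le_gradient (hid he₂i) hΛ hFi he₁i he₂i hL' hΓ' hA hAs
      hAu hg hG hH
    rw [one_mul, ← integral_multivariateGaussian_zero hg.continuous] at hmain
    have hgd := hg.differentiable two_ne_zero
    have h1 := abs_integral_comp_sub_le hf.continuous hgd hG hgf hFi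
    have h2 := abs_integral_comp_sub_le hf.continuous hgd hG hgf
      (IsGaussian.integrable_id (μ := multivariateGaussian 0 Sig))
    simp only [id] at h2
    rw [abs_le] at h1 h2 hmain ⊢
    simp only [invSqrt]
    constructor
    · linarith [h1.1, h1.2, h2.1, h2.2, hmain.1]
    · linarith [h1.1, h1.2, h2.1, h2.2, hmain.2]
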